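/- Let $\mathbf k$ be an imaginary quadratic field with a fixed embedding into $\mathbb C$, ring of integers $\mathcal O$, finite adeles $\hat{\mathbf k}$ and $\hat{\mathcal O}=\mathcal O\otimes\hat{\mathbb Z}$; let $\mathfrak m\subset\mathcal O$ be a nonzero ideal, $I_{\mathfrak m}$ the group of fractional ideals coprime to $\mathfrak m$, and $k\ge 1$ an integer. Let $\varrho:I_{\mathfrak m}\to\mathbb C^\times$ be an algebraic Hecke character of weight $k$ and modulus $\mathfrak m$: a homomorphism with $\varrho(\alpha\mathcal O)=\alpha^{k-1}$ whenever $\alpha\equiv 1 \bmod \mathfrak m$, where $\mathfrak m$ is the largest ideal with this property. If $k=1$, assume that $\varrho$ is not trivial. Put $\varrho(\mathfrak a)=0$ if $\mathfrak a$ is not coprime to $\mathfrak m$, and $$\vartheta_\varrho(\tau)=\sum_{0\ne\mathfrak a\subset\mathcal O}\varrho(\mathfrak a)q^{\mathrm{Nm}(\mathfrak a)},\qquad \eta(\alpha)=\varrho(\alpha\mathcal O)/\alpha^{k-1},\qquad q=e^{2\pi i\tau},\ \mathrm{Im}\,\tau>0;$$ $\eta$ induces a character of $(\mathcal O/\mathfrak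 m)^\times$. Let $K(\mathfrak m)=\{u\in\hat{\mathcal O}^\times: u\in 1+\mathfrak m\hat{\mathcal O}\}$, and let $\hat{\mathbf k}_{(\mathfrak m)}^\times$ be the group of finite ideles $t$ with $t_v\in 1+\mathfrak m\mathcal O_v$ for all $v\mid\mathfrak m$. View $\varrho$ also as the character of $\hat{\mathbf k}^\times$ that satisfies $\varrho(\alpha)=\alpha^{k-1}$ for $\alpha\in\mathbf k^\times$ and that agrees on $\hat{\mathbf k}_{(\mathfrak m)}^\times$ with the value of $\varrho$ at the associated fractional ideal. For $h\in\hat{\mathbf k}^\times$ put $\mathrm{Nm}^-(h)=h/\bar h$. For an open compact subgroup $K_{\mathrm f}\subset\hat{\mathcal O}^\times$ let $\mathrm{Cl}(K_{\mathrm f})=\mathbf k^\times\backslash\hat{\mathbf k}^\times/K_{\mathrm f}$ and $\mathrm{Vol}(K_{\mathrm f})=[\hat{\mathcal O}^\times:K_{\mathrm f}]^{-1}\,|\mathcal O^\times|\,|K_{\mathrm f}\cap\mathcal O^\times|^{-1}$. For a lattice $(P,a\,\mathrm{Nm})$, where $P\subset\mathbf k$ is a fractional ideal and $a\in\mathbb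 Q_{>0}$, for a coset $P+\mu$ with $\mu\in\mathbf k$, and for $\phi_\mu=\mathrm{char}(\hat P+\mu)$, define $$\theta_{P+\mu}(\tau,h)=\sum_{x\in\mathbf k}\phi_\mu\big((\bar h/h)x\big)x^{k-1}q^{a\mathrm{Nm}(x)},\qquad \theta_{\varrho,P+\mu}(\tau)=\mathrm{Vol}(K_{\mathrm f})\sum_{h\in\mathrm{Cl}(K_{\mathrm f})}\varrho(h/\bar h)^{-1}\,\theta_{P+\mu}(\tau,h),$$ where $K_{\mathrm f}$ is any open compact subgroup of $\hat{\mathcal O}^\times$ such that $\mathrm{Nm}^-(K_{\mathrm f})$ lies in $\ker\varrho$ and fixes $\phi_\mu$. Let $t_1,\dots,t_\ell,h_1,\dots,h_n\in\hat{\mathbf k}_{(\mathfrak m)}^\times$ be such that the $t_i\,\mathrm{Nm}^-(h_j)$ ($1\le i\le\ell$, $1\le j\le n$) form a set of representatives of $\mathrm{Cl}(K(\mathfrak m))$. Let $\mathfrak a_i$ be the fractional ideal of $t_i$, let $a_i=\mathrm{Nm}(\mathfrak a_i)$, and let $P_i$ be the lattice $(\mathfrak m\mathfrak a_i,\ a_i^{-1}\mathrm{Nm})$.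 For $\mu\in(\mathcal O/\mathfrak m)^\times$ let $P_i+\mu$ be the coset of $P_i$ of any representative of $\mu$ in $\mathcal O\cap\mathfrak a_i$. Then all the series above converge absolutely, and $$\vartheta_\varrho(\tau)=\frac{1}{\ell\,|\mathcal O^\times|}\sum_{i=1}^{\ell}\ \sum_{\mu\in(\mathcal O/\mathfrak m)^\times}\varrho(t_i)^{-1}\,\eta(\mu)\,\theta_{\varrho,P_i+\mu}(\tau).$$ Moreover, the same formula holds without the factor $1/\ell$ if the sum over all of $\mathrm{Cl}(K_{\mathrm f})$ in $\theta_{\varrho,P_i+\mu}$ is replaced by the sum over $h_1,\dots,h_n$ at level $K(\mathfrak m)$: $$\vartheta_\varrho(\tau)=\frac{1}{|\mathcal O^\times|}\sum_{i=1}^{\ell}\ \sum_{\mu\in(\mathcal O/\mathfrak m)^\times}\varrho(t_i)^{-1}\,\eta(\mu)\;\mathrm{Vol}(K(\mathfrak m))\sum_{j=1}^{n}\varrho(h_j/\bar h_j)^{-1}\,\theta_{P_i+\mu}(\tau,h_j).$$ -/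

import Mathlib

open NumberField IsDedekindDomain nonZeroDivisors UpperHalfPlane

noncomputable section
namespace CMTheta

variable {K : Type*} [Field K]

/-- The prime `e⁻¹(w)`, for an automorphism `e` of `K`. -/
def primeComap (e : K ≃+* K) (w : HeightOneSpectrum (𝓞 K)) : HeightOneSpectrum (𝓞 K) :=
  w.comap (RingOfIntegers.mapRingEquiv e : 𝓞 K →+* 𝓞 K) (RingOfIntegers.mapRingEquiv e).surjective

theorem primeComap_injective (e : K ≃+* K) : Function.Injective (primeComap e) := by
  intro v w h
  have h1 := congrArg HeightOneSpectrum.asIdeal h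
  apply HeightOneSpectrum.ext
  exact Ideal.comap_injective_of_surjective _ (RingOfIntegers.mapRingEquiv e).surjective h1

theorem mem_primeComap_pow (e : K ≃+* K) (w : HeightOneSpectrum (𝓞 K)) (n : ℕ) (r : 𝓞 K) :
    r ∈ (primeComap e w).asIdeal ^ n ↔ RingOfIntegers.mapRingEquiv e r ∈ w.asIdeal ^ n := by
  set f := RingOfIntegers.mapRingEquiv e
  have h1 : (primeComap e w).asIdeal = w.asIdeal.map f.symm := Ideal.comap_symm f.symm
  rw [h1, ← Ideal.map_pow, Ideal.map_symm]
  rfl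

variable [NumberField K]

theorem intValuation_primeComap (e : K ≃+* K) (w : HeightOneSpectrum (𝓞 K)) (r : 𝓞 K) :
    (primeComap e w).intValuation r = w.intValuation (RingOfIntegers.mapRingEquiv e r) := by
  by_cases hr : r = 0
  · simp [hr]
  have hr' : RingOfIntegers.mapRingEquiv e r ≠ 0 := by simpa using hr
  have key : ∀ n : ℕ, (primeComap e w).intValuation r ≤ WithZero.exp (-(n : ℤ)) ↔
      w.intValuation (RingOfIntegers.mapRingEquiv e r) ≤ WithZero.exp (-(n : ℤ)) := by
    intro n
    rw [HeightOneSpectrum.intValuation_le_pow_iff_mem, HeightOneSpectrum.intValuation_le_pow_iff_mem,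
      mem_primeComap_pow]
  rw [HeightOneSpectrum.intValuation_if_neg _ hr, HeightOneSpectrum.intValuation_if_neg _ hr'] at *
  apply le_antisymm
  · exact (key _).2 le_rfl
  · exact (key _).1 le_rfl

theorem valuation_primeComap (e : K ≃+* K) (w : HeightOneSpectrum (𝓞 K)) (x : K) :
    (primeComap e w).valuation K x = w.valuation K (e x) := by
  obtain ⟨a, b, hb, rfl⟩ := IsFractionRing.div_surjective (A := 𝓞 K) x
  have h : ∀ r : 𝓞 K, e (algebraMap (𝓞 K) K r) =
    algebraMap (𝓞 K) K (RingOfIntegers.mapRingEquiv e r) := fun r => rfl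
  simp only [map_div₀, h, HeightOneSpectrum.valuation_of_algebraMap, intValuation_primeComap]

theorem continuous_withValMap (e : K ≃+* K) (w : HeightOneSpectrum (𝓞 K)) :
    Continuous (WithVal.map ((primeComap e w).valuation K) (w.valuation K) (e : K →+* K)) := by
  apply continuous_of_continuousAt_zero
  rw [ContinuousAt, map_zero]
  intro s hs
  obtain ⟨γ, hγ⟩ := Valued.mem_nhds_zero.1 hs
  obtain ⟨y, hy⟩ := MonoidWithZeroHom.ValueGroup₀.restrict₀_surjective _ γ.val
  rw [Filter.mem_map, Valued.mem_nhds_zero]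
  have hy0 : y ≠ 0 := by
    rintro rfl
    rw [map_zero] at hy
    exact γ.ne_zero hy.symm
  let z : WithVal ((primeComap e w).valuation K) := WithVal.toVal _ (e.symm y.ofVal)
  have hz : z ≠ 0 := by simpa [z] using hy0
  have hz0 : Valued.v.restrict z ≠ 0 := by
    rw [Ne, map_eq_zero]
    exact hz
  refine ⟨Units.mk0 (Valued.v.restrict z) hz0, fun x hx => hγ ?_⟩
  have hx' : Valued.v.restrict x < Valued.v.restrict z := hx
  rw [Valuation.restrict_lt_iff] at hx'
  change Valued.v.restrict _ < γ.val
  rw [← hy]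
  change Valued.v.restrict _ < Valued.v.restrict y
  rw [Valuation.restrict_lt_iff]
  rw [← WithVal.apply_ofVal, ← WithVal.apply_ofVal] at hx' ⊢
  rw [valuation_primeComap, valuation_primeComap] at hx'
  simpa [z] using hx'

/-- The isomorphism of completions `K_{e⁻¹ w} → K_w` induced by an automorphism `e` of `K`. -/
def completionMap (e : K ≃+* K) (w : HeightOneSpectrum (𝓞 K)) :
    (primeComap e w).adicCompletion K →+* w.adicCompletion K :=
  ((HeightOneSpectrum.adicCompletion.equiv K w).symm : _ →+* _).comp
    ((UniformSpace.Completion.mapRingHom _ (continuous_withValMap e w)).comp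
      (HeightOneSpectrum.adicCompletion.equiv K (primeComap e w) : _ →+* _))

theorem completionMap_coe (e : K ≃+* K) (w : HeightOneSpectrum (𝓞 K)) (x : K) :
    completionMap e w (x : (primeComap e w).adicCompletion K) = ((e x : K) : w.adicCompletion K) := by
  apply HeightOneSpectrum.adicCompletion.ext
  exact UniformSpace.Completion.mapRingHom_coe (continuous_withValMap e w) _

theorem completionMap_mapsTo (e : K ≃+* K) (w : HeightOneSpectrum (𝓞 K)) :
    Set.MapsTo (completionMap e w) ((primeComap e w).adicCompletionIntegers K)
      (w.adicCompletionIntegers K) := by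
  have key : ∀ y : ((primeComap e w).valuation K).Completion, Valued.v y ≤ 1 →
      Valued.v (UniformSpace.Completion.mapRingHom _ (continuous_withValMap e w) y) ≤ 1 := by
    intro y
    induction y using UniformSpace.Completion.induction_on with
    | hp =>
      simp only [imp_iff_not_or]
      refine IsClosed.union ?_ ?_
      · exact (Valued.isOpen_integer ((primeComap e w).valuation K).Completion).isClosed_compl
      · have hc : Continuous (UniformSpace.Completion.mapRingHom _ (continuous_withValMap e w)) :=
          UniformSpace.Completion.continuous_map
        exact (Valued.isClosed_integer (w.valuation K).Completion).preimage hc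
    | ih a =>
      rw [UniformSpace.Completion.mapRingHom_coe, Valued.valuedCompletion_apply,
        Valued.valuedCompletion_apply, ← WithVal.apply_ofVal, ← WithVal.apply_ofVal,
        valuation_primeComap]
      exact id
  intro x hx
  exact key x.toCompletion hx

/-- The automorphism of the finite adele ring of `K` induced by an automorphism `e` of `K`. -/
def adeleMap (e : K ≃+* K) : FiniteAdeleRing (𝓞 K) K →+* FiniteAdeleRing (𝓞 K) K :=
  RestrictedProduct.mapAlongRingHom
    (fun v : HeightOneSpectrum (𝓞 K) => v.adicCompletion K)
    (fun v : HeightOneSpectrum (𝓞 K) => v.adicCompletion K)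
    (primeComap e) (primeComap_injective e).tendsto_cofinite
    (completionMap e) (Filter.Eventually.of_forall (completionMap_mapsTo e))

theorem adeleMap_apply (e : K ≃+* K) (x : FiniteAdeleRing (𝓞 K) K) (w : HeightOneSpectrum (𝓞 K)) :
    adeleMap e x w = completionMap e w (x (primeComap e w)) := rfl

theorem adeleMap_algebraMap (e : K ≃+* K) (x : K) :
    adeleMap e (algebraMap K _ x) = algebraMap K _ (e x) := by
  apply FiniteAdeleRing.ext
  intro w
  exact completionMap_coe e w x

/-! ### Complex conjugation and the map `Nm⁻` -/

section Conj

variable (K) [Algebra.IsQuadraticExtension ℚ K] [IsTotallyComplex K]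

/-- The nontrivial automorphism `z ↦ z̄` of the imaginary quadratic field `K`. -/
def conj : K ≃+* K :=
  haveI : IsCMField K := IsCMField.ofCMExtension ℚ K
  (IsCMField.complexConj K).toRingEquiv

theorem embedding_conj (σ : K →+* ℂ) (x : K) : σ (conj K x) = star (σ x) :=
  haveI : IsCMField K := IsCMField.ofCMExtension ℚ K
  IsCMField.complexEmbedding_complexConj K σ x

/-- The homomorphism `Nm⁻ : h ↦ h / h̄` on finite ideles of `K`. -/
def normMinus : (FiniteAdeleRing (𝓞 K) K)ˣ →* (FiniteAdeleRing (𝓞 K) K)ˣ :=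
  MonoidHom.id _ / Units.map (adeleMap (conj K) : FiniteAdeleRing (𝓞 K) K →* _)

end Conj

/-! ### Lattices, congruence subgroups and class groups -/

/-- The completion `P_v ⊆ K_v` of a fractional ideal `P` of `K`. -/
def localIdeal (v : HeightOneSpectrum (𝓞 K)) (P : FractionalIdeal (𝓞 K)⁰ K) :
    Submodule (v.adicCompletionIntegers K) (v.adicCompletion K) :=
  Submodule.span _ ((fun x : K => (x : v.adicCompletion K)) '' {x : K | x ∈ P})

/-- The open compact subset `P̂ = P ⊗ ℤ̂ = ∏ᵥ P_v` of the finite adeles. -/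
def hat (P : FractionalIdeal (𝓞 K)⁰ K) : Set (FiniteAdeleRing (𝓞 K) K) :=
  {x | ∀ v, x v ∈ localIdeal v P}

/-- The characteristic function `φ_{P + μ}` of `μ + P̂`. -/
def cosetIndicator (P : FractionalIdeal (𝓞 K)⁰ K) (μ : K) : FiniteAdeleRing (𝓞 K) K → ℂ :=
  Set.indicator {x | x - algebraMap K _ μ ∈ hat P} 1

variable (K) in
/-- The maximal compact subgroup `Ô_K^×` of the finite ideles. -/
def integralUnits : Subgroup (FiniteAdeleRing (𝓞 K) K)ˣ where
  carrier := {u | ∀ v, Valued.v ((u : FiniteAdeleRing (𝓞 K) K) v) = 1}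
  one_mem' v := map_one _
  mul_mem' {a b} ha hb v := by
    have h : ((a * b : (FiniteAdeleRing (𝓞 K) K)ˣ) : FiniteAdeleRing (𝓞 K) K) v =
      (a : FiniteAdeleRing (𝓞 K) K) v * (b : FiniteAdeleRing (𝓞 K) K) v := rfl
    rw [h, map_mul, ha v, hb v, one_mul]
  inv_mem' {a} ha v := by
    have h : (a : FiniteAdeleRing (𝓞 K) K) v *
      ((a⁻¹ : (FiniteAdeleRing (𝓞 K) K)ˣ) : FiniteAdeleRing (𝓞 K) K) v = 1 :=
      congrArg (fun x : FiniteAdeleRing (𝓞 K) K => x v) a.mul_inv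
    have h2 := congrArg Valued.v h
    rwa [map_mul, ha v, one_mul, map_one] at h2

/-- `K(𝔪) = ∏_{v ∤ 𝔪} O_v^× × ∏_{v ∣ 𝔪} (1 + 𝔪 O_v)`, written uniformly as the group of the
units `u` of `Ô_K` with `u - 1 ∈ 𝔪 O_v` for all `v`. -/
def levelSubgroup (m : Ideal (𝓞 K)) : Subgroup (FiniteAdeleRing (𝓞 K) K)ˣ where
  carrier := {u | u ∈ integralUnits K ∧
    ∀ v, (u : FiniteAdeleRing (𝓞 K) K) v - 1 ∈ localIdeal v (m : FractionalIdeal (𝓞 K)⁰ K)}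
  one_mem' := ⟨one_mem _, fun v => by
    have h : ((1 : (FiniteAdeleRing (𝓞 K) K)ˣ) : FiniteAdeleRing (𝓞 K) K) v = 1 := rfl
    rw [h, sub_self]; exact zero_mem _⟩
  mul_mem' {a b} ha hb := ⟨mul_mem ha.1 hb.1, fun v => by
    have h : ((a * b : (FiniteAdeleRing (𝓞 K) K)ˣ) : FiniteAdeleRing (𝓞 K) K) v =
      (a : FiniteAdeleRing (𝓞 K) K) v * (b : FiniteAdeleRing (𝓞 K) K) v := rfl
    have e : (a : FiniteAdeleRing (𝓞 K) K) v * (b : FiniteAdeleRing (𝓞 K) K) v - 1 =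
      (a : FiniteAdeleRing (𝓞 K) K) v * ((b : FiniteAdeleRing (𝓞 K) K) v - 1) +
        ((a : FiniteAdeleRing (𝓞 K) K) v - 1) := by ring
    rw [h, e]
    exact add_mem (Submodule.smul_mem _
      (⟨_, (ha.1 v).le⟩ : v.adicCompletionIntegers K) (hb.2 v)) (ha.2 v)⟩
  inv_mem' {a} ha := ⟨inv_mem ha.1, fun v => by
    have h : (a : FiniteAdeleRing (𝓞 K) K) v *
      ((a⁻¹ : (FiniteAdeleRing (𝓞 K) K)ˣ) : FiniteAdeleRing (𝓞 K) K) v = 1 :=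
      congrArg (fun x : FiniteAdeleRing (𝓞 K) K => x v) a.mul_inv
    have e : ((a⁻¹ : (FiniteAdeleRing (𝓞 K) K)ˣ) : FiniteAdeleRing (𝓞 K) K) v - 1 =
      -(((a⁻¹ : (FiniteAdeleRing (𝓞 K) K)ˣ) : FiniteAdeleRing (𝓞 K) K) v *
        ((a : FiniteAdeleRing (𝓞 K) K) v - 1)) := by linear_combination h
    rw [e]
    exact neg_mem (Submodule.smul_mem _
      (⟨_, ((inv_mem ha.1 : a⁻¹ ∈ integralUnits K) v).le⟩ : v.adicCompletionIntegers K) (ha.2 v))⟩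

/-- `K̂_{(𝔪)}^×`: the finite ideles `t` with `t_v ∈ 1 + 𝔪 O_v` for all `v ∣ 𝔪`. -/
def coprimeIdeles (m : Ideal (𝓞 K)) : Set (FiniteAdeleRing (𝓞 K) K)ˣ :=
  {t | ∀ v : HeightOneSpectrum (𝓞 K), m ≤ v.asIdeal →
    (t : FiniteAdeleRing (𝓞 K) K) v - 1 ∈ localIdeal v (m : FractionalIdeal (𝓞 K)⁰ K)}

/-- `Cl(K_f) = K^× \ K̂^× / K_f`. -/
abbrev IdeleClassGroup (Kf : Subgroup (FiniteAdeleRing (𝓞 K) K)ˣ) : Type _ :=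
  (FiniteAdeleRing (𝓞 K) K)ˣ ⧸ ((FiniteAdeleRing.unitEmbedding (𝓞 K) K).range ⊔ Kf)

/-- `Vol(K_f) = [Ô_K^× : K_f]⁻¹ · |O_K^×| · |K_f ∩ O_K^×|⁻¹`. -/
def vol (Kf : Subgroup (FiniteAdeleRing (𝓞 K) K)ˣ) : ℂ :=
  ((Kf.relIndex (integralUnits K) : ℂ))⁻¹ * (Nat.card (𝓞 K)ˣ : ℂ) *
    (Nat.card ↥(Kf ⊓ (Units.map
      (algebraMap (𝓞 K) (FiniteAdeleRing (𝓞 K) K) : 𝓞 K →* _)).range) : ℂ)⁻¹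

/-- The fractional ideal `∏ᵥ 𝔭_v ^ {ord_v(t_v)}` of a finite idele `t`. -/
def ideleIdeal (t : (FiniteAdeleRing (𝓞 K) K)ˣ) : (FractionalIdeal (𝓞 K)⁰ K)ˣ :=
  ∏ᶠ v : HeightOneSpectrum (𝓞 K),
    (FractionalIdeal.mk0 K ⟨v.asIdeal, mem_nonZeroDivisors_of_ne_zero v.ne_bot⟩) ^
      (-WithZero.log (Valued.v ((t : FiniteAdeleRing (𝓞 K) K) v)))

/-- `I_𝔪`: the group of fractional ideals of `K` coprime to `𝔪`. -/
def coprimeIdeals (m : Ideal (𝓞 K)) : Subgroup (FractionalIdeal (𝓞 K)⁰ K)ˣ where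
  carrier := {a | ∀ v : HeightOneSpectrum (𝓞 K), m ≤ v.asIdeal →
    FractionalIdeal.count K v (a : FractionalIdeal (𝓞 K)⁰ K) = 0}
  one_mem' v _ := FractionalIdeal.count_one K v
  mul_mem' {a b} ha hb v hv := by
    rw [Units.val_mul, FractionalIdeal.count_mul K v a.ne_zero b.ne_zero, ha v hv, hb v hv,
      add_zero]
  inv_mem' {a} ha v hv := by
    rw [Units.val_inv_eq_inv_val, FractionalIdeal.count_inv, ha v hv, neg_zero]

/-! ### Algebraic Hecke characters -/

/-- An algebraic Hecke character of weight `k` on `I_𝔪` (with `K` embedded in `ℂ` by `σ`): a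
homomorphism on `I_𝔪` with `ϱ(αO) = α^{k-1}` for all `α ≡ 1 mod 𝔪`, that is, `α ∈ 1 + 𝔪 O_v` for
all `v ∣ 𝔪`. -/
structure HeckeCharacter (σ : K →+* ℂ) (k : ℕ) (m : Ideal (𝓞 K)) where
  /-- The homomorphism on `I_𝔪`. -/
  toHom : coprimeIdeals m →* ℂˣ
  map_principal : ∀ (α : Kˣ) (hα : toPrincipalIdeal (𝓞 K) K α ∈ coprimeIdeals m),
    FiniteAdeleRing.unitEmbedding (𝓞 K) K α ∈ coprimeIdeles m →
      (toHom ⟨toPrincipalIdeal (𝓞 K) K α, hα⟩ : ℂ) = σ α ^ (k - 1)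

namespace HeckeCharacter

variable {σ : K →+* ℂ} {k : ℕ} {m : Ideal (𝓞 K)} (ϱ : HeckeCharacter σ k m)

/-- `ϱ` has modulus `𝔪`: no ideal `𝔣 ⊋ 𝔪` has the property that `ϱ(αO) = α^{k-1}` for all
`αO ∈ I_𝔪` with `α ≡ 1 mod 𝔣`. -/
def HasModulus : Prop :=
  ∀ f : Ideal (𝓞 K), m ≤ f →
    (∀ (α : Kˣ) (hα : toPrincipalIdeal (𝓞 K) K α ∈ coprimeIdeals m),
      FiniteAdeleRing.unitEmbedding (𝓞 K) K α ∈ coprimeIdeles f →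
        (ϱ.toHom ⟨toPrincipalIdeal (𝓞 K) K α, hα⟩ : ℂ) = σ α ^ (k - 1)) → f = m

open Classical in
/-- `ϱ(𝔞)`, extended by zero to the ideals not coprime to `𝔪`. -/
def onIdeal (a : (FractionalIdeal (𝓞 K)⁰ K)ˣ) : ℂ :=
  if ha : a ∈ coprimeIdeals m then (ϱ.toHom ⟨a, ha⟩ : ℂ) else 0

/-- `η(α) = ϱ(αO) / α^{k-1}`. -/
def eta (α : Kˣ) : ℂ := ϱ.onIdeal (toPrincipalIdeal (𝓞 K) K α) / σ α ^ (k - 1)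

open Classical in
/-- `ϱ` as a character of the finite ideles: the homomorphism on `K̂^×` with
`ϱ(α) = α^{k-1}` for `α ∈ K^×` and `ϱ(t) = ϱ(𝔞)` if `t ∈ K̂_{(𝔪)}^×` has the ideal `𝔞`. Its value
at `h` is obtained by choosing `α ∈ K^×` with `αh ∈ K̂_{(𝔪)}^×`; it does not depend on `α`. -/
def onIdele (h : (FiniteAdeleRing (𝓞 K) K)ˣ) : ℂ :=
  if H : ∃ α : Kˣ, FiniteAdeleRing.unitEmbedding (𝓞 K) K α * h ∈ coprimeIdeles m then
    (σ H.choose ^ (k - 1))⁻¹ *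
      ϱ.onIdeal (ideleIdeal (FiniteAdeleRing.unitEmbedding (𝓞 K) K H.choose * h))
  else 0

/-- The term `ϱ(𝔞) q^{Nm 𝔞}`, `q = e^{2πiτ}`, of the form `ϑ_ϱ`, for a nonzero integral ideal `𝔞`. -/
def formTerm (τ : ℍ) (a : (Ideal (𝓞 K))⁰) : ℂ :=
  ϱ.onIdeal (FractionalIdeal.mk0 K a) *
    Complex.exp (2 * Real.pi * Complex.I * τ * (Ideal.absNorm (a : Ideal (𝓞 K)) : ℂ))

/-- The form `ϑ_ϱ(τ) = ∑_𝔞 ϱ(𝔞) q^{Nm 𝔞}`. -/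
def form (τ : ℍ) : ℂ := ∑' a : (Ideal (𝓞 K))⁰, ϱ.formTerm τ a

end HeckeCharacter

/-! ### Binary theta series -/

section Theta

variable [Algebra.IsQuadraticExtension ℚ K] [IsTotallyComplex K]

/-- The term `φ((h̄/h) x) x^{k-1} q^{a Nm x}` of the theta series of the quadratic space
`(K, a Nm)`. -/
def thetaTerm (σ : K →+* ℂ) (k : ℕ) (a : ℚ) (φ : FiniteAdeleRing (𝓞 K) K → ℂ)
    (h : (FiniteAdeleRing (𝓞 K) K)ˣ) (τ : ℍ) (x : K) : ℂ :=
  φ (((normMinus K h)⁻¹ : (FiniteAdeleRing (𝓞 K) K)ˣ) * algebraMap K _ x) * σ x ^ (k - 1) *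
    Complex.exp (2 * Real.pi * Complex.I * τ * ((a * Algebra.norm ℚ x : ℚ) : ℂ))

/-- The theta series `θ(τ, ω(h)φ) = ∑_{x ∈ K} φ((h̄/h) x) x^{k-1} q^{a Nm x}`. -/
def theta (σ : K →+* ℂ) (k : ℕ) (a : ℚ) (φ : FiniteAdeleRing (𝓞 K) K → ℂ)
    (h : (FiniteAdeleRing (𝓞 K) K)ˣ) (τ : ℍ) : ℂ :=
  ∑' x : K, thetaTerm σ k a φ h τ x

variable {σ : K →+* ℂ} {k : ℕ} {m : Ideal (𝓞 K)}

/-- `K_f` is an open (compact) subgroup of `Ô_K^×` such that `Nm⁻(K_f)` lies in the kernel of `ϱ`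
and fixes `φ`; the twisted theta series of `φ` can then be computed at level `K_f`. -/
structure IsLevel (ϱ : HeckeCharacter σ k m) (φ : FiniteAdeleRing (𝓞 K) K → ℂ)
    (Kf : Subgroup (FiniteAdeleRing (𝓞 K) K)ˣ) : Prop where
  isOpen : IsOpen (Kf : Set (FiniteAdeleRing (𝓞 K) K)ˣ)
  le_integralUnits : Kf ≤ integralUnits K
  map_eq_one : ∀ u ∈ Kf, ϱ.onIdele (normMinus K u) = 1
  fixes : ∀ u ∈ Kf, ∀ x : FiniteAdeleRing (𝓞 K) K,
    φ (((normMinus K u)⁻¹ : (FiniteAdeleRing (𝓞 K) K)ˣ) * x) = φ x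

/-- The twisted theta series
`θ_ϱ(τ, φ) = Vol(K_f) ∑_{h ∈ Cl(K_f)} ϱ(h/h̄)⁻¹ ∑_{x ∈ K} φ((h̄/h) x) x^{k-1} q^{a Nm x}`
for the quadratic space `(K, a Nm)` (for `K_f` with `IsLevel ϱ φ K_f` the summands depend only on
the classes, and the sum does not depend on `K_f`). -/
def twistedTheta (ϱ : HeckeCharacter σ k m) (Kf : Subgroup (FiniteAdeleRing (𝓞 K) K)ˣ) (a : ℚ)
    (φ : FiniteAdeleRing (𝓞 K) K → ℂ) (τ : ℍ) : ℂ :=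
  vol Kf * ∑ᶠ c : IdeleClassGroup Kf,
    (ϱ.onIdele (normMinus K c.out))⁻¹ * theta σ k a φ c.out τ

end Theta

end CMTheta
end

/-!
Fix a finite idele `t` prime to `𝔪` and an arbitrary one `h`. Choose `α ∈ K^×` such that `α (h/h̄)`
is prime to `𝔪`, and substitute `x = α⁻¹ y` in the theta series of `P + μ` at `h`: it then runs over
the `y ≡ μ mod 𝔪` in the ideal `B` of `α (h/h̄) t`. Weight by `η(μ)` and sum over `μ`. Since `h/h̄`
has norm one, a nonzero `y ∈ B` contributes `ϱ(yB⁻¹) q^Nm(yB⁻¹)`. As `y` varies, `yB⁻¹` runs over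
the integral ideals in the inverse of the class of `B`, each met `|O^×|` times. So
`∑_μ ϱ(t)⁻¹ η(μ) ϱ(h/h̄)⁻¹ θ_{P+μ}(τ, h)` depends only on the ideal class of `t (h/h̄)`: it is
`|O^×|` times a partial sum of `ϑ_ϱ`, plus, when `k = 1` and `𝔪 = O`, the constant term `ϱ(B)⁻¹`
coming from `y = 0`. The constant terms cancel over the class group because `ϱ` is not trivial.

It remains to average over classes. As `Cl(K_f) → Cl(K)` is a surjective homomorphism and
`Vol(K_f) |Cl(K_f)| = |Cl(K)|`, the sum over the representatives `t_i (h_j/h̄_j)` of `Cl(K(𝔪))`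
gives the second formula. In the first formula the sum over `h ∈ Cl(K_f)` is unchanged when `h` is
multiplied by `h_j`. Averaging over `j` turns it into `ℓ` times the sum over `Cl(K)`.
-/

noncomputable section
namespace CMTheta

open scoped NumberField.AdeleRing IsDedekindDomain.FiniteAdeleRing

/-! ### Fractional ideals and valuations -/

section FractionalIdeals

open FractionalIdeal

variable {R : Type*} [CommRing R] [IsDedekindDomain R]
variable {K : Type*} [Field K] [Algebra R K] [IsFractionRing R K]

theorem valuation_eq_exp_neg_count (v : HeightOneSpectrum R) {x : K} (hx : x ≠ 0) :
    v.valuation K x = WithZero.exp (-count K v (spanSingleton R⁰ x)) := by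
  obtain ⟨a, b, hb, rfl⟩ := IsFractionRing.div_surjective (A := R) x
  have hb0 : b ≠ 0 := nonZeroDivisors.ne_zero hb
  have ha0 : a ≠ 0 := by rintro rfl; simp at hx
  rw [count_well_defined K v (a := b) (J := Ideal.span {a}) (spanSingleton_ne_zero_iff.2 hx)
      (by rw [coeIdeal_span_singleton, spanSingleton_mul_spanSingleton, div_eq_inv_mul]),
    map_div₀, HeightOneSpectrum.valuation_of_algebraMap, HeightOneSpectrum.valuation_of_algebraMap,
    HeightOneSpectrum.intValuation_if_neg _ ha0, HeightOneSpectrum.intValuation_if_neg _ hb0,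
    ← WithZero.exp_sub]
  congr 1
  ring

theorem le_one_of_count_nonneg {P : FractionalIdeal R⁰ K} (h : ∀ v, 0 ≤ count K v P) : P ≤ 1 := by
  rcases eq_or_ne P 0 with rfl | hP
  · exact zero_le
  rw [← finprod_heightOneSpectrum_factorization' K hP]
  refine finprod_induction (· ≤ (1 : FractionalIdeal R⁰ K)) le_rfl
    (fun _ _ => mul_le_one') fun v => ?_
  obtain ⟨n, hn⟩ := Int.eq_ofNat_of_zero_le (h v)
  rw [hn, zpow_natCast]
  exact pow_le_one' coeIdeal_le_one n

theorem le_iff_count_le {P Q : FractionalIdeal R⁰ K} (hP : P ≠ 0) (hQ : Q ≠ 0) :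
    P ≤ Q ↔ ∀ v, count K v Q ≤ count K v P := by
  refine ⟨fun h v => count_mono K v hP h, fun h => ?_⟩
  have hPQ : P * Q⁻¹ ≤ 1 := le_one_of_count_nonneg fun v => by
    rw [count_mul K v hP (inv_ne_zero hQ), count_inv]
    linarith [h v]
  calc P = P * Q⁻¹ * Q := by rw [mul_assoc, inv_mul_cancel₀ hQ, mul_one]
    _ ≤ 1 * Q := mul_le_mul_left hPQ Q
    _ = Q := one_mul Q

theorem units_ext_count {I J : (FractionalIdeal R⁰ K)ˣ}
    (h : ∀ v : HeightOneSpectrum R, count K v I = count K v J) : I = J := by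
  apply Units.ext
  rw [← finprod_heightOneSpectrum_factorization' K I.ne_zero,
    ← finprod_heightOneSpectrum_factorization' K J.ne_zero]
  simp only [h]

theorem mem_iff_valuation_le {P : FractionalIdeal R⁰ K} (hP : P ≠ 0) (x : K) :
    x ∈ P ↔ ∀ v : HeightOneSpectrum R, v.valuation K x ≤ WithZero.exp (-count K v P) := by
  rcases eq_or_ne x 0 with rfl | hx
  · simpa using P.zero_mem
  rw [← spanSingleton_le_iff_mem, le_iff_count_le (spanSingleton_ne_zero_iff.2 hx) hP]
  simp_rw [valuation_eq_exp_neg_count _ hx, WithZero.exp_le_exp, neg_le_neg_iff]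

theorem exists_mem_valuation_eq (v : HeightOneSpectrum R) {P : FractionalIdeal R⁰ K}
    (hP : P ≠ 0) : ∃ x ∈ P, v.valuation K x = WithZero.exp (-count K v P) := by
  by_contra! h
  have hv : (v.asIdeal : FractionalIdeal R⁰ K) ≠ 0 := coeIdeal_ne_zero.2 v.ne_bot
  have hle : P ≤ P * v.asIdeal := by
    intro x hx
    rw [mem_iff_valuation_le (mul_ne_zero hP hv)]
    intro w
    have hxw := (mem_iff_valuation_le hP x).1 hx w
    rw [count_mul K w hP hv]
    rcases eq_or_ne v w with rfl | hw
    · rcases eq_or_ne x 0 with rfl | hx0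
      · simp
      have hlt := lt_of_le_of_ne hxw (h x hx)
      rw [valuation_eq_exp_neg_count _ hx0, WithZero.exp_lt_exp] at hlt
      rw [valuation_eq_exp_neg_count _ hx0, WithZero.exp_le_exp, count_self]
      linarith
    · rwa [count_maximal_coprime K w hw, add_zero]
  have := count_mono K v hP hle
  rw [count_mul K v hP hv, count_self] at this
  linarith

theorem count_pos_of_le {m : Ideal R} (hm : m ≠ ⊥) {v : HeightOneSpectrum R} (hv : m ≤ v.asIdeal) :
    0 < count K v (m : FractionalIdeal R⁰ K) := by
  have := count_mono K v (coeIdeal_ne_zero.2 hm) ((coeIdeal_le_coeIdeal K).2 hv)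
  rw [count_self] at this
  lia

theorem count_eq_zero_of_not_le {m : Ideal R} (hm : m ≠ ⊥) {v : HeightOneSpectrum R}
    (hv : ¬ m ≤ v.asIdeal) : count K v (m : FractionalIdeal R⁰ K) = 0 := by
  rw [count_coe K v hm, Nat.cast_eq_zero, ← not_ne_iff,
    Associates.count_ne_zero_iff_dvd hm v.irreducible, Ideal.dvd_iff_le]
  exact hv

theorem finite_primes_above {m : Ideal R} (hm : m ≠ ⊥) :
    {v : HeightOneSpectrum R | m ≤ v.asIdeal}.Finite := by
  simpa only [Ideal.dvd_iff_le] using Ideal.finite_factors hm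

theorem toPrincipalIdeal_eq_one_iff {α : Kˣ} :
    toPrincipalIdeal R K α = 1 ↔ ∃ u : Rˣ, Units.map (algebraMap R K : R →* K) u = α := by
  rw [toPrincipalIdeal_eq_iff, Units.val_one]
  constructor
  · intro h
    have hmem : ∀ β : Kˣ, spanSingleton R⁰ (β : K) ≤ 1 → ∃ y, algebraMap R K y = β := fun β hβ =>
      (mem_one_iff R⁰).1 (spanSingleton_le_iff_mem.1 hβ)
    obtain ⟨y, hy⟩ := hmem α h.le
    obtain ⟨z, hz⟩ := hmem α⁻¹ <| by
      rw [Units.val_inv_eq_inv_val, ← spanSingleton_inv, h, inv_one]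
    have hyz : y * z = 1 := FaithfulSMul.algebraMap_injective R K <| by
      rw [map_mul, hy, hz, map_one, Units.mul_inv]
    exact ⟨⟨y, z, hyz, by rw [mul_comm, hyz]⟩, Units.ext hy⟩
  · rintro ⟨u, rfl⟩
    rw [Units.coe_map, MonoidHom.coe_coe, ← coeIdeal_span_singleton,
      Ideal.span_singleton_eq_top.2 u.isUnit, coeIdeal_top]

theorem classGroup_mk_eq_one_iff {I : (FractionalIdeal R⁰ K)ˣ} :
    ClassGroup.mk K I = 1 ↔ ∃ α : Kˣ, toPrincipalIdeal R K α = I := by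
  rw [ClassGroup.mk_eq_one_iff, isPrincipal_iff]
  constructor
  · rintro ⟨x, hx⟩
    have hx0 : x ≠ 0 := spanSingleton_ne_zero_iff.1 (hx ▸ I.ne_zero)
    exact ⟨Units.mk0 x hx0, toPrincipalIdeal_eq_iff.2 hx.symm⟩
  · rintro ⟨α, rfl⟩
    exact ⟨α, coe_toPrincipalIdeal α⟩

variable (R K) in
theorem classGroup_mk_surjective : Function.Surjective (ClassGroup.mk (R := R) K) := by
  intro c
  obtain ⟨I, rfl⟩ := ClassGroup.mk0_surjective c
  exact ⟨_, ClassGroup.mk_mk0 K I⟩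

end FractionalIdeals

section Approximation

variable {R : Type*} [CommRing R] [IsDedekindDomain R]
variable {K : Type*} [Field K] [Algebra R K] [IsFractionRing R K]

theorem adicCompletion_coe_sub (v : HeightOneSpectrum R) (x y : K) :
    ((x - y : K) : v.adicCompletion K) = x - y :=
  map_sub (algebraMap K (v.adicCompletion K)) x y

theorem exists_valued_sub_le (v : HeightOneSpectrum R) (x : v.adicCompletion K) (n : ℤ) :
    ∃ a : K, Valued.v ((a : v.adicCompletion K) - x) ≤ WithZero.exp n := by
  obtain ⟨c, hc⟩ := v.valuation_surjective K (WithZero.exp n)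
  rw [← HeightOneSpectrum.valuedAdicCompletion_eq_valuation'] at hc
  have hopen : IsOpen {y : v.adicCompletion K |
      (y - x) / (c : v.adicCompletion K) ∈ v.adicCompletionIntegers K} :=
    (Valued.isOpen_valuationSubring (v.adicCompletion K)).preimage
      ((continuous_id.sub continuous_const).div_const _)
  obtain ⟨a, ha⟩ := (HeightOneSpectrum.denseRange_algebraMap (R := R) K v).exists_mem_open hopen
    ⟨x, by simp⟩
  have ha' : Valued.v (((a : v.adicCompletion K) - x) / (c : v.adicCompletion K)) ≤ 1 := ha
  rw [map_div₀, hc, div_le_one₀ (WithZero.zero_lt_coe _)] at ha'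
  exact ⟨a, ha'⟩

theorem exists_exp_neg_natCast_le {γ : WithZero (Multiplicative ℤ)} (hγ : γ ≠ 0) :
    ∃ N : ℕ, WithZero.exp (-(N : ℤ)) ≤ γ := by
  refine ⟨(-WithZero.log γ).toNat, ?_⟩
  rw [← WithZero.le_log_iff_exp_le hγ]
  lia

theorem exists_forall_valuation_sub_le (S : Finset (HeightOneSpectrum R))
    (a : HeightOneSpectrum R → K) (c : HeightOneSpectrum R → ℤ) :
    ∃ x : K, ∀ v ∈ S, v.valuation K (x - a v) ≤ WithZero.exp (c v) := by
  obtain ⟨d, hd⟩ := IsLocalization.exist_integer_multiples R⁰ S a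
  have hd0 : algebraMap R K d ≠ 0 := by simp
  have hd0' (v : HeightOneSpectrum R) : v.valuation K (algebraMap R K d) ≠ 0 :=
    (Valuation.ne_zero_iff _).2 hd0
  choose! b hb using hd
  choose N hN using fun v : HeightOneSpectrum R =>
    exists_exp_neg_natCast_le (mul_ne_zero (WithZero.exp_ne_zero (a := c v)) (hd0' v))
  obtain ⟨y, hy⟩ := IsDedekindDomain.exists_forall_sub_mem_ideal (s := S)
    (fun v : HeightOneSpectrum R => v.asIdeal) N (fun v _ => v.prime)
    (fun v _ w _ hvw h => hvw (HeightOneSpectrum.ext h)) (fun v => b v)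
  refine ⟨algebraMap R K y / algebraMap R K d, fun v hv => ?_⟩
  have hyv := (HeightOneSpectrum.intValuation_le_pow_iff_mem v _ _).2 (hy v hv)
  rw [← HeightOneSpectrum.valuation_of_algebraMap (K := K)] at hyv
  change v.valuation K (algebraMap R K (y - b v)) ≤ _ at hyv
  rw [map_sub, hb v hv, Algebra.smul_def] at hyv
  rw [div_sub' hd0, map_div₀, div_le_iff₀ (zero_lt_iff.2 (hd0' v))]
  exact hyv.trans (hN v)

theorem exists_forall_valued_sub_le {S : Set (HeightOneSpectrum R)} (hS : S.Finite)
    (x : ∀ v : HeightOneSpectrum R, v.adicCompletion K) (c : HeightOneSpectrum R → ℤ) :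
    ∃ α : K, ∀ v ∈ S, Valued.v ((α : v.adicCompletion K) - x v) ≤ WithZero.exp (c v) := by
  choose a ha using fun v : HeightOneSpectrum R => exists_valued_sub_le v (x v) (c v)
  obtain ⟨α, hα⟩ := exists_forall_valuation_sub_le hS.toFinset a c
  refine ⟨α, fun v hv => ?_⟩
  have hαv := hα v (hS.mem_toFinset.2 hv)
  rw [← HeightOneSpectrum.valuedAdicCompletion_eq_valuation'] at hαv
  rw [← sub_add_sub_cancel, ← adicCompletion_coe_sub]
  exact Valuation.map_add_le _ hαv (ha v)

end Approximation

/-! ### Finite ideles and their ideals -/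

section Ideles

open FractionalIdeal

section Dedekind

variable {R : Type*} [CommRing R] [IsDedekindDomain R]
variable {K : Type*} [Field K] [Algebra R K] [IsFractionRing R K]

theorem idele_apply_ne_zero (t : 𝔸ᶠ[R, K]ˣ) (v : HeightOneSpectrum R) : (t : 𝔸ᶠ[R, K]) v ≠ 0 :=
  (FiniteAdeleRing.isUnit_iff.1 t.isUnit).1 v

theorem valued_idele_ne_zero (t : 𝔸ᶠ[R, K]ˣ) (v : HeightOneSpectrum R) :
    Valued.v ((t : 𝔸ᶠ[R, K]) v) ≠ 0 :=
  (Valuation.ne_zero_iff _).2 (idele_apply_ne_zero t v)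

theorem idele_mul_apply (s t : 𝔸ᶠ[R, K]ˣ) (v : HeightOneSpectrum R) :
    ((s * t : 𝔸ᶠ[R, K]ˣ) : 𝔸ᶠ[R, K]) v = (s : 𝔸ᶠ[R, K]) v * (t : 𝔸ᶠ[R, K]) v := rfl

theorem idele_inv_apply (t : 𝔸ᶠ[R, K]ˣ) (v : HeightOneSpectrum R) :
    ((t⁻¹ : 𝔸ᶠ[R, K]ˣ) : 𝔸ᶠ[R, K]) v = ((t : 𝔸ᶠ[R, K]) v)⁻¹ := by
  apply eq_inv_of_mul_eq_one_left
  rw [← idele_mul_apply, inv_mul_cancel]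
  rfl

theorem unitEmbedding_apply (α : Kˣ) (v : HeightOneSpectrum R) :
    (FiniteAdeleRing.unitEmbedding R K α : 𝔸ᶠ[R, K]) v = ((α : K) : v.adicCompletion K) := rfl

theorem eventually_log_valued_idele_eq_zero (t : 𝔸ᶠ[R, K]ˣ) :
    ∀ᶠ v : HeightOneSpectrum R in Filter.cofinite,
      -WithZero.log (Valued.v ((t : 𝔸ᶠ[R, K]) v)) = 0 := by
  filter_upwards [(FiniteAdeleRing.isUnit_iff.1 t.isUnit).2] with v hv
  rw [hv, WithZero.log_one, neg_zero]

theorem exists_idele_valued_eq_exp (n : HeightOneSpectrum R → ℤ)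
    (hn : ∀ᶠ v in Filter.cofinite, n v = 0) :
    ∃ t : 𝔸ᶠ[R, K]ˣ, ∀ v, Valued.v ((t : 𝔸ᶠ[R, K]) v) = WithZero.exp (n v) := by
  choose x hx using fun v : HeightOneSpectrum R => v.valuation_surjective K (WithZero.exp (n v))
  simp_rw [← HeightOneSpectrum.valuedAdicCompletion_eq_valuation'] at hx
  have hone : ∀ᶠ v : HeightOneSpectrum R in Filter.cofinite,
      Valued.v ((x v : K) : v.adicCompletion K) = 1 := by
    filter_upwards [hn] with v hv
    rw [hx, hv, WithZero.exp_zero]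
  let a : 𝔸ᶠ[R, K] := ⟨fun v => ((x v : K) : v.adicCompletion K), hone.mono fun _ hv => hv.le⟩
  have ha : IsUnit a := FiniteAdeleRing.isUnit_iff.2 ⟨fun v => by
    rw [← Valuation.ne_zero_iff (Valued.v : Valuation (v.adicCompletion K) _)]
    exact (hx v).trans_ne WithZero.exp_ne_zero, hone⟩
  exact ⟨ha.unit, hx⟩

end Dedekind

variable {K : Type*} [Field K] [NumberField K]

theorem mem_localIdeal_iff (v : HeightOneSpectrum (𝓞 K)) {P : FractionalIdeal (𝓞 K)⁰ K}
    (hP : P ≠ 0) (x : v.adicCompletion K) :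
    x ∈ localIdeal v P ↔ Valued.v x ≤ WithZero.exp (-count K v P) := by
  constructor
  · intro hx
    induction hx using Submodule.span_induction with
    | mem y hy =>
      obtain ⟨p, hp, rfl⟩ := hy
      rw [HeightOneSpectrum.valuedAdicCompletion_eq_valuation']
      exact (mem_iff_valuation_le hP p).1 hp v
    | zero => simp
    | add y z _ _ hy hz => exact Valuation.map_add_le _ hy hz
    | smul a y _ hy =>
      rw [show a • y = (a : v.adicCompletion K) * y from rfl, map_mul]
      exact (mul_le_mul' a.2 hy).trans (one_mul _).le
  · intro hx
    obtain ⟨p, hp, hpv⟩ := exists_mem_valuation_eq v hP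
    rw [← HeightOneSpectrum.valuedAdicCompletion_eq_valuation'] at hpv
    have hp0 : (p : v.adicCompletion K) ≠ 0 :=
      (Valuation.ne_zero_iff _).1 (hpv.trans_ne WithZero.exp_ne_zero)
    have hmem : x / (p : v.adicCompletion K) ∈ v.adicCompletionIntegers K := by
      rw [HeightOneSpectrum.mem_adicCompletionIntegers, map_div₀, hpv]
      exact div_le_one_of_le₀ hx zero_le
    rw [← div_mul_cancel₀ x hp0]
    exact Submodule.smul_mem _ (⟨_, hmem⟩ : v.adicCompletionIntegers K)
      (Submodule.subset_span ⟨p, hp, rfl⟩)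

theorem count_ideleIdeal (t : 𝔸ᶠ[K]ˣ) (v : HeightOneSpectrum (𝓞 K)) :
    count K v (ideleIdeal t) = -WithZero.log (Valued.v ((t : 𝔸ᶠ[K]) v)) := by
  have hfin := eventually_log_valued_idele_eq_zero t
  rw [← count_finprod K v _ hfin]
  congr 1
  rw [ideleIdeal, ← Units.coeHom_apply, MonoidHom.map_finprod]
  · exact finprod_congr fun w => by simp
  · refine (Filter.eventually_cofinite.1 hfin).subset fun w hw h0 => hw ?_
    simp only [h0, zpow_zero]

theorem valued_idele (t : 𝔸ᶠ[K]ˣ) (v : HeightOneSpectrum (𝓞 K)) :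
    Valued.v ((t : 𝔸ᶠ[K]) v) = WithZero.exp (-count K v (ideleIdeal t)) := by
  rw [count_ideleIdeal, neg_neg, WithZero.exp_log (valued_idele_ne_zero t v)]

theorem ideleIdeal_mul (s t : 𝔸ᶠ[K]ˣ) :
    ideleIdeal (s * t) = ideleIdeal s * ideleIdeal t := by
  refine units_ext_count fun v => ?_
  rw [Units.val_mul, count_mul K v (Units.ne_zero _) (Units.ne_zero _)]
  simp only [count_ideleIdeal, idele_mul_apply, map_mul]
  rw [WithZero.log_mul (valued_idele_ne_zero s v) (valued_idele_ne_zero t v), neg_add]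

variable (K) in
/-- The map `ideleIdeal` from finite ideles to fractional ideals, as a group homomorphism. -/
def ideleIdealHom : 𝔸ᶠ[K]ˣ →* (FractionalIdeal (𝓞 K)⁰ K)ˣ :=
  MonoidHom.mk' ideleIdeal ideleIdeal_mul

theorem ideleIdeal_inv (t : 𝔸ᶠ[K]ˣ) : ideleIdeal t⁻¹ = (ideleIdeal t)⁻¹ :=
  map_inv (ideleIdealHom K) t

theorem ideleIdeal_unitEmbedding (α : Kˣ) :
    ideleIdeal (FiniteAdeleRing.unitEmbedding (𝓞 K) K α) = toPrincipalIdeal (𝓞 K) K α := by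
  refine units_ext_count fun v => ?_
  rw [count_ideleIdeal, coe_toPrincipalIdeal, unitEmbedding_apply,
    HeightOneSpectrum.valuedAdicCompletion_eq_valuation',
    valuation_eq_exp_neg_count v α.ne_zero, WithZero.log_exp, neg_neg]

theorem ideleIdeal_eq_one_iff {t : 𝔸ᶠ[K]ˣ} : ideleIdeal t = 1 ↔ t ∈ integralUnits K := by
  refine ⟨fun h v => ?_, fun h => units_ext_count fun v => ?_⟩
  · rw [valued_idele, h, Units.val_one, count_one, neg_zero, WithZero.exp_zero]
  · rw [count_ideleIdeal, h v, Units.val_one, count_one, WithZero.log_one, neg_zero]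

variable (K) in
theorem ideleIdealHom_surjective : Function.Surjective (ideleIdealHom K) := by
  intro I
  obtain ⟨t, ht⟩ := exists_idele_valued_eq_exp (K := K)
    (fun v : HeightOneSpectrum (𝓞 K) => -count K v (I : FractionalIdeal (𝓞 K)⁰ K))
    ((finite_factors (I : FractionalIdeal (𝓞 K)⁰ K)).mono fun v hv => neg_eq_zero.2 hv)
  refine ⟨t, units_ext_count fun v => ?_⟩
  change count K v (ideleIdeal t : FractionalIdeal (𝓞 K)⁰ K) = _
  rw [count_ideleIdeal, ht, WithZero.log_exp, neg_neg]

theorem mem_coprimeIdeles_iff {m : Ideal (𝓞 K)} (hm : m ≠ ⊥) {t : 𝔸ᶠ[K]ˣ} :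
    t ∈ coprimeIdeles m ↔ ∀ v : HeightOneSpectrum (𝓞 K), m ≤ v.asIdeal →
      Valued.v ((t : 𝔸ᶠ[K]) v - 1) ≤
        WithZero.exp (-count K v (m : FractionalIdeal (𝓞 K)⁰ K)) := by
  simp only [coprimeIdeles, Set.mem_ofPred_eq, mem_localIdeal_iff _ (coeIdeal_ne_zero.2 hm)]

theorem exists_unitEmbedding_mul_mem_coprimeIdeles {m : Ideal (𝓞 K)} (hm : m ≠ ⊥)
    (t : 𝔸ᶠ[K]ˣ) :
    ∃ α : Kˣ, FiniteAdeleRing.unitEmbedding (𝓞 K) K α * t ∈ coprimeIdeles m := by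
  by_cases hS : ∃ v : HeightOneSpectrum (𝓞 K), m ≤ v.asIdeal
  swap
  · exact ⟨1, fun v hv => (hS ⟨v, hv⟩).elim⟩
  obtain ⟨α, hα⟩ := exists_forall_valued_sub_le (finite_primes_above hm)
    (fun v => ((t : 𝔸ᶠ[K]) v)⁻¹)
    (fun v => count K v (ideleIdeal t) - count K v (m : FractionalIdeal (𝓞 K)⁰ K))
  have key (v : HeightOneSpectrum (𝓞 K)) (hv : m ≤ v.asIdeal) :
      Valued.v ((α : v.adicCompletion K) * (t : 𝔸ᶠ[K]) v - 1) ≤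
        WithZero.exp (-count K v (m : FractionalIdeal (𝓞 K)⁰ K)) := by
    rw [← inv_mul_cancel₀ (idele_apply_ne_zero t v), ← sub_mul, map_mul, valued_idele]
    refine (mul_le_mul' (hα v hv) le_rfl).trans_eq ?_
    rw [← WithZero.exp_add]
    ring_nf
  have hα0 : α ≠ 0 := by
    rintro rfl
    obtain ⟨v, hv⟩ := hS
    have hle := key v hv
    rw [HeightOneSpectrum.adicCompletion.coe_zero, zero_mul, zero_sub, Valuation.map_neg,
      map_one, ← WithZero.exp_zero, WithZero.exp_le_exp] at hle
    linarith [count_pos_of_le (K := K) hm hv]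
  exact ⟨Units.mk0 α hα0, (mem_coprimeIdeles_iff hm).2 key⟩

end Ideles

/-! ### Idele class groups and their volumes -/

section Index

theorem index_sup_mul_card {G : Type*} [CommGroup G] (P : Subgroup G) {U V : Subgroup G}
    (hVU : V ≤ U) : (P ⊔ V).index * Nat.card ↥(P ⊓ U) =
      (P ⊔ U).index * V.relIndex U * Nat.card ↥(V ⊓ P) := by
  have hindex : (P ⊔ V).index = (P ⊔ V).relIndex U * (P ⊔ U).index := by
    rw [← Subgroup.relIndex_mul_index (sup_le_sup_left hVU P),
      ← Subgroup.relIndex_sup_left (H := U) (K := P ⊔ V), sup_assoc, sup_eq_right.2 hVU]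
  have hrel : V.relIndex U = V.relIndex (P ⊓ U) * (P ⊔ V).relIndex U := by
    have hmod : (P ⊔ V) ⊓ U = V ⊔ P ⊓ U := by rw [sup_comm, sup_inf_assoc_of_le P hVU]
    rw [← Subgroup.relIndex_mul_relIndex V ((P ⊔ V) ⊓ U) U (le_inf le_sup_right hVU) inf_le_right,
      Subgroup.inf_relIndex_right, hmod, Subgroup.relIndex_sup_left]
  have hcard : Nat.card ↥(P ⊓ U) = Nat.card ↥(V ⊓ P) * V.relIndex (P ⊓ U) := by
    have hinf : V ⊓ P = V ⊓ (P ⊓ U) := by rw [inf_comm P U, ← inf_assoc, inf_eq_left.2 hVU]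
    rw [← Subgroup.inf_relIndex_right V (P ⊓ U), ← hinf, ← Subgroup.relIndex_bot_left,
      ← Subgroup.relIndex_bot_left]
    exact (Subgroup.relIndex_mul_relIndex _ _ _ bot_le (hinf.le.trans inf_le_right)).symm
  rw [hindex, hrel, hcard]
  ring

variable {K : Type*} [Field K] [NumberField K]

variable (K) in
/-- The homomorphism from finite ideles to ideal classes. -/
def ideleClass : 𝔸ᶠ[K]ˣ →* ClassGroup (𝓞 K) := (ClassGroup.mk K).comp (ideleIdealHom K)

variable (K) in
theorem ideleClass_surjective : Function.Surjective (ideleClass K) :=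
  (classGroup_mk_surjective (𝓞 K) K).comp (ideleIdealHom_surjective K)

theorem ideleClass_unitEmbedding (α : Kˣ) :
    ideleClass K (FiniteAdeleRing.unitEmbedding (𝓞 K) K α) = 1 :=
  classGroup_mk_eq_one_iff.2 ⟨α, (ideleIdeal_unitEmbedding α).symm⟩

variable (K) in
theorem ker_ideleClass : (ideleClass K).ker =
    (FiniteAdeleRing.unitEmbedding (𝓞 K) K).range ⊔ integralUnits K := by
  apply le_antisymm
  · intro t ht
    obtain ⟨α, hα⟩ := classGroup_mk_eq_one_iff.1 ht
    rw [← ideleIdeal_unitEmbedding] at hα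
    refine Subgroup.mem_sup.2 ⟨_, ⟨α, rfl⟩, (FiniteAdeleRing.unitEmbedding (𝓞 K) K α)⁻¹ * t,
      ideleIdeal_eq_one_iff.1 ?_, mul_inv_cancel_left _ _⟩
    rw [ideleIdeal_mul, ideleIdeal_inv, inv_mul_eq_one, hα]
    rfl
  · refine sup_le ?_ fun u hu => ?_
    · rintro _ ⟨α, rfl⟩
      exact ideleClass_unitEmbedding α
    · change ClassGroup.mk K (ideleIdeal u) = 1
      rw [ideleIdeal_eq_one_iff.2 hu, map_one]

theorem le_ker_ideleClass {Kf : Subgroup 𝔸ᶠ[K]ˣ} (hle : Kf ≤ integralUnits K) :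
    (FiniteAdeleRing.unitEmbedding (𝓞 K) K).range ⊔ Kf ≤ (ideleClass K).ker :=
  (sup_le_sup_left hle _).trans_eq (ker_ideleClass K).symm

variable (K) in
/-- The subgroup `O_K^×` of the finite ideles, written as in the definition of `vol`. -/
def globalUnits : Subgroup 𝔸ᶠ[K]ˣ :=
  (Units.map (algebraMap (𝓞 K) 𝔸ᶠ[K] : 𝓞 K →* _)).range

variable (K) in
theorem unitEmbedding_range_inf_integralUnits :
    (FiniteAdeleRing.unitEmbedding (𝓞 K) K).range ⊓ integralUnits K = globalUnits K := by
  have hmap (u : (𝓞 K)ˣ) : Units.map (algebraMap (𝓞 K) 𝔸ᶠ[K] : 𝓞 K →* _) u =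
      FiniteAdeleRing.unitEmbedding (𝓞 K) K (Units.map (algebraMap (𝓞 K) K : 𝓞 K →* K) u) :=
    Units.ext rfl
  apply le_antisymm
  · rintro _ ⟨⟨α, rfl⟩, hα⟩
    obtain ⟨u, rfl⟩ := toPrincipalIdeal_eq_one_iff.1
      ((ideleIdeal_unitEmbedding α).symm.trans (ideleIdeal_eq_one_iff.2 hα))
    exact ⟨u, hmap u⟩
  · rintro _ ⟨u, rfl⟩
    refine ⟨⟨_, (hmap u).symm⟩, ideleIdeal_eq_one_iff.1 ?_⟩
    rw [hmap, ideleIdeal_unitEmbedding, toPrincipalIdeal_eq_one_iff]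
    exact ⟨u, rfl⟩

variable (K) in
theorem algebraMap_finiteAdeleRing_injective :
    Function.Injective (algebraMap (𝓞 K) 𝔸ᶠ[K]) := by
  obtain ⟨p, hp, hprime⟩ := Ring.not_isField_iff_exists_prime.1 (RingOfIntegers.not_isField K)
  let v : HeightOneSpectrum (𝓞 K) := ⟨p, hprime, hp⟩
  intro x y hxy
  have hv : (algebraMap (𝓞 K) K x : v.adicCompletion K) = algebraMap (𝓞 K) K y :=
    congrArg (fun z : 𝔸ᶠ[K] => z v) hxy
  exact FaithfulSMul.algebraMap_injective (𝓞 K) K ((algebraMap K (v.adicCompletion K)).injective hv)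

variable (K) in
theorem card_globalUnits : Nat.card (globalUnits K) = Nat.card (𝓞 K)ˣ :=
  (Nat.card_congr (MonoidHom.ofInjective (Units.map_injective
    (algebraMap_finiteAdeleRing_injective K))).toEquiv).symm

theorem card_ideleClassGroup_mul_card_units {Kf : Subgroup 𝔸ᶠ[K]ˣ}
    (hle : Kf ≤ integralUnits K) :
    Nat.card (IdeleClassGroup Kf) * Nat.card (𝓞 K)ˣ =
      Nat.card (ClassGroup (𝓞 K)) * Kf.relIndex (integralUnits K) *
        Nat.card ↥(Kf ⊓ globalUnits K) := by
  have key := index_sup_mul_card (FiniteAdeleRing.unitEmbedding (𝓞 K) K).range hle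
  have hinf : Kf ⊓ (FiniteAdeleRing.unitEmbedding (𝓞 K) K).range = Kf ⊓ globalUnits K := by
    rw [← unitEmbedding_range_inf_integralUnits, inf_comm _ (integralUnits K), ← inf_assoc,
      inf_eq_left.2 hle]
  rwa [hinf, unitEmbedding_range_inf_integralUnits, ← ker_ideleClass, Subgroup.index_ker,
    MonoidHom.range_eq_top.2 (ideleClass_surjective K), Subgroup.card_top, card_globalUnits] at key

theorem card_inf_globalUnits_ne_zero [Finite (𝓞 K)ˣ] (Kf : Subgroup 𝔸ᶠ[K]ˣ) :
    Nat.card ↥(Kf ⊓ globalUnits K) ≠ 0 := by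
  have : Finite (globalUnits K) :=
    Nat.finite_of_card_ne_zero (card_globalUnits K ▸ Nat.card_pos.ne')
  have : Finite ↥(Kf ⊓ globalUnits K) :=
    Finite.of_injective _ (Subgroup.inclusion_injective (inf_le_right (a := Kf)))
  exact Nat.card_pos.ne'

theorem finite_ideleClassGroup_iff [Finite (𝓞 K)ˣ] {Kf : Subgroup 𝔸ᶠ[K]ˣ}
    (hle : Kf ≤ integralUnits K) :
    Finite (IdeleClassGroup Kf) ↔ Kf.relIndex (integralUnits K) ≠ 0 := by
  have key := card_ideleClassGroup_mul_card_units hle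
  have hunits : Nat.card (𝓞 K)ˣ ≠ 0 := Nat.card_pos.ne'
  have hclass : Nat.card (ClassGroup (𝓞 K)) ≠ 0 := Nat.card_pos.ne'
  constructor
  · intro hfin hindex
    rw [hindex, mul_zero, zero_mul] at key
    exact mul_ne_zero Nat.card_pos.ne' hunits key
  · refine fun hindex => Nat.finite_of_card_ne_zero fun h0 => ?_
    rw [h0, zero_mul] at key
    exact mul_ne_zero (mul_ne_zero hclass hindex) (card_inf_globalUnits_ne_zero Kf) key.symm

theorem vol_mul_card_ideleClassGroup [Finite (𝓞 K)ˣ] {Kf : Subgroup 𝔸ᶠ[K]ˣ}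
    (hle : Kf ≤ integralUnits K) [hfin : Finite (IdeleClassGroup Kf)] :
    vol Kf * Nat.card (IdeleClassGroup Kf) = Nat.card (ClassGroup (𝓞 K)) := by
  have key := congrArg (Nat.cast : ℕ → ℂ) (card_ideleClassGroup_mul_card_units hle)
  have hindex := (Nat.cast_ne_zero (R := ℂ)).2 ((finite_ideleClassGroup_iff hle).1 hfin)
  have hcard := (Nat.cast_ne_zero (R := ℂ)).2 (card_inf_globalUnits_ne_zero Kf)
  have hvol : vol Kf = ((Kf.relIndex (integralUnits K) : ℂ))⁻¹ * (Nat.card (𝓞 K)ˣ : ℂ) *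
    (Nat.card ↥(Kf ⊓ globalUnits K) : ℂ)⁻¹ := rfl
  push_cast at key
  rw [hvol]
  field_simp
  linear_combination key

end Index

/-! ### Complex conjugation and norms -/

section Conjugation

variable {K : Type*} [Field K] [NumberField K]

theorem absNorm_primeComap (e : K ≃+* K) (w : HeightOneSpectrum (𝓞 K)) :
    Ideal.absNorm (primeComap e w).asIdeal = Ideal.absNorm w.asIdeal := by
  simp only [Ideal.absNorm_apply, Submodule.cardQuot_apply]
  exact Nat.card_congr (Ideal.quotientEquiv _ _ (RingOfIntegers.mapRingEquiv e)
    (Ideal.map_comap_of_surjective _ (RingOfIntegers.mapRingEquiv e).surjective _).symm).toEquiv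

theorem absNorm_ideleIdeal (t : 𝔸ᶠ[K]ˣ) :
    FractionalIdeal.absNorm (ideleIdeal t : FractionalIdeal (𝓞 K)⁰ K) =
      ∏ᶠ v : HeightOneSpectrum (𝓞 K), (Ideal.absNorm v.asIdeal : ℚ) ^
        (-WithZero.log (Valued.v ((t : 𝔸ᶠ[K]) v))) := by
  let N : (FractionalIdeal (𝓞 K)⁰ K)ˣ →* ℚ :=
    (FractionalIdeal.absNorm (K := K) (R := 𝓞 K) : _ →* ℚ).comp (Units.coeHom _)
  change N (ideleIdeal t) = _
  rw [ideleIdeal, MonoidHom.map_finprod]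
  · exact finprod_congr fun v => by simp [N, FractionalIdeal.coeIdeal_absNorm]
  · refine (Filter.eventually_cofinite.1 (eventually_log_valued_idele_eq_zero t)).subset
      fun w hw h0 => hw ?_
    simp only [h0, zpow_zero]

theorem valued_completionMap_eq_one (e : K ≃+* K) (w : HeightOneSpectrum (𝓞 K))
    {x : (primeComap e w).adicCompletion K} (hx : Valued.v x = 1) :
    Valued.v (completionMap e w x) = 1 := by
  have hx0 : x ≠ 0 := (Valuation.ne_zero_iff _).1 (hx.trans_ne one_ne_zero)
  have hinv : Valued.v (completionMap e w x⁻¹) ≤ 1 :=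
    completionMap_mapsTo e w (HeightOneSpectrum.mem_adicCompletionIntegers _ _ _ |>.2 <| by
      rw [map_inv₀, hx, inv_one])
  rw [map_inv₀, map_inv₀, inv_le_one₀ (zero_lt_iff.2 <|
    (Valuation.ne_zero_iff _).2 ((map_ne_zero _).2 hx0))] at hinv
  exact le_antisymm (completionMap_mapsTo e w hx.le) hinv

theorem valued_completionMap (e : K ≃+* K) (w : HeightOneSpectrum (𝓞 K))
    (x : (primeComap e w).adicCompletion K) :
    Valued.v (completionMap e w x) = Valued.v x := by
  rcases eq_or_ne x 0 with rfl | hx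
  · simp
  have hvx : Valued.v x ≠ 0 := (Valuation.ne_zero_iff _).2 hx
  obtain ⟨a, ha⟩ := (primeComap e w).valuation_surjective K (Valued.v x)
  rw [← HeightOneSpectrum.valuedAdicCompletion_eq_valuation'] at ha
  have hdiv := valued_completionMap_eq_one e w
    (x := x / (a : (primeComap e w).adicCompletion K)) (by rw [map_div₀, ha, div_self hvx])
  rw [map_div₀, map_div₀, completionMap_coe, HeightOneSpectrum.valuedAdicCompletion_eq_valuation',
    ← valuation_primeComap, ← HeightOneSpectrum.valuedAdicCompletion_eq_valuation', ha] at hdiv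
  exact (div_eq_one_iff_eq hvx).1 hdiv

theorem absNorm_ideleIdeal_map_adeleMap (e : K ≃+* K) (t : 𝔸ᶠ[K]ˣ) :
    FractionalIdeal.absNorm (ideleIdeal (Units.map (adeleMap e : 𝔸ᶠ[K] →* 𝔸ᶠ[K]) t) :
        FractionalIdeal (𝓞 K)⁰ K) =
      FractionalIdeal.absNorm (ideleIdeal t : FractionalIdeal (𝓞 K)⁰ K) := by
  rw [absNorm_ideleIdeal, absNorm_ideleIdeal]
  refine Eq.trans (finprod_congr fun w => ?_) (finprod_comp_equiv
    (HeightOneSpectrum.equivOfRingEquiv (RingOfIntegers.mapRingEquiv e)).symm)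
  change _ = (Ideal.absNorm (primeComap e w).asIdeal : ℚ) ^
    (-WithZero.log (Valued.v ((t : 𝔸ᶠ[K]) (primeComap e w))))
  rw [absNorm_primeComap, ← valued_completionMap e w]
  rfl

variable [Algebra.IsQuadraticExtension ℚ K] [IsTotallyComplex K]

theorem absNorm_ideleIdeal_normMinus (t : 𝔸ᶠ[K]ˣ) :
    FractionalIdeal.absNorm (ideleIdeal (normMinus K t) : FractionalIdeal (𝓞 K)⁰ K) = 1 := by
  have hmul : normMinus K t * Units.map (adeleMap (conj K) : 𝔸ᶠ[K] →* _) t = t :=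
    div_mul_cancel _ _
  have hnorm := congrArg (fun s => FractionalIdeal.absNorm
    (ideleIdeal s : FractionalIdeal (𝓞 K)⁰ K)) hmul
  simp only [ideleIdeal_mul, Units.val_mul, map_mul, absNorm_ideleIdeal_map_adeleMap] at hnorm
  refine mul_right_cancel₀ ?_ (hnorm.trans (one_mul _).symm)
  rw [Ne, FractionalIdeal.absNorm_eq_zero_iff]
  exact Units.ne_zero _

theorem normMinus_unitEmbedding (α : Kˣ) :
    normMinus K (FiniteAdeleRing.unitEmbedding (𝓞 K) K α) =
      FiniteAdeleRing.unitEmbedding (𝓞 K) K (α / Units.map (conj K : K →* K) α) := by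
  have hconj : Units.map (adeleMap (conj K) : 𝔸ᶠ[K] →* _)
      (FiniteAdeleRing.unitEmbedding (𝓞 K) K α) =
        FiniteAdeleRing.unitEmbedding (𝓞 K) K (Units.map (conj K : K →* K) α) :=
    Units.ext (adeleMap_algebraMap (conj K) α)
  rw [map_div, ← hconj]
  rfl

theorem normMinus_mem_integralUnits {u : 𝔸ᶠ[K]ˣ} (hu : u ∈ integralUnits K) :
    normMinus K u ∈ integralUnits K :=
  div_mem hu fun w => (valued_completionMap (conj K) w _).trans (hu _)

theorem algebraNorm_eq_norm_sq (σ : K →+* ℂ) (x : K) :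
    ((Algebra.norm ℚ x : ℚ) : ℝ) = ‖σ x‖ ^ 2 := by
  classical
  have hne : σ ≠ ComplexEmbedding.conjugate σ := fun h =>
    IsTotallyComplex.complexEmbedding_not_isReal σ h.symm
  have huniv : ({σ, ComplexEmbedding.conjugate σ} : Finset (K →+* ℂ)) = Finset.univ := by
    apply Finset.eq_univ_of_card
    rw [Finset.card_pair hne, Embeddings.card, Algebra.IsQuadraticExtension.finrank_eq_two]
  have h := Algebra.norm_eq_prod_embeddings ℚ ℂ x
  rw [← Fintype.prod_equiv (RingHom.equivRatAlgHom K ℂ) (fun f => f x)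
    (fun φ => φ x) fun _ => by simp [RingHom.equivRatAlgHom_apply], ← huniv,
    Finset.prod_pair hne, ComplexEmbedding.conjugate_coe_eq, Complex.mul_conj,
    Complex.normSq_eq_norm_sq] at h
  rw [eq_ratCast] at h
  exact_mod_cast h

theorem algebraNorm_nonneg (x : K) : 0 ≤ Algebra.norm ℚ x := by
  have h := algebraNorm_eq_norm_sq (Classical.arbitrary (K →+* ℂ)) x
  exact_mod_cast h ▸ sq_nonneg ‖(Classical.arbitrary (K →+* ℂ)) x‖

theorem infinitePlace_apply_eq_norm (σ : K →+* ℂ) (w : InfinitePlace K) (x : K) :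
    w x = ‖σ x‖ := by
  have h := algebraNorm_eq_norm_sq σ x
  rw [algebraNorm_eq_norm_sq w.embedding x, InfinitePlace.norm_embedding_eq] at h
  exact (pow_left_inj₀ (apply_nonneg w x) (norm_nonneg _) two_ne_zero).1 h

variable (K) in
theorem finite_units : Finite (𝓞 K)ˣ := by
  have hrank : Units.rank K = 0 := by
    have hplaces := IsTotallyComplex.finrank K
    rw [Algebra.IsQuadraticExtension.finrank_eq_two] at hplaces
    rw [Units.rank, InfinitePlace.card_eq_nrRealPlaces_add_nrComplexPlaces,
      IsTotallyComplex.nrRealPlaces_eq_zero]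
    lia
  have : IsEmpty (Fin (Units.rank K)) := by
    rw [hrank]
    infer_instance
  refine Finite.of_surjective (Subtype.val : Units.torsion K → (𝓞 K)ˣ) fun u => ?_
  obtain ⟨⟨ζ, e⟩, hu, -⟩ := Units.exist_unique_eq_mul_prod K u
  exact ⟨ζ, by rw [hu, Finset.univ_eq_empty, Finset.prod_empty, mul_one]⟩

end Conjugation

section Lattice

theorem pow_mul_exp_neg_mul_sq_le (M : ℕ) (r : ℝ) {c : ℝ} (hc : 0 < c) :
    r ^ M * Real.exp (-(c * r ^ 2)) ≤ 1 + M.factorial / c ^ M := by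
  have hsq : r ^ M ≤ 1 + (r ^ 2) ^ M := by
    rw [← pow_mul, mul_comm, pow_mul]
    nlinarith [sq_nonneg (r ^ M - 1)]
  have hpow : (r ^ 2) ^ M ≤ M.factorial / c ^ M * Real.exp (c * r ^ 2) := by
    have h := Real.pow_div_factorial_le_exp (c * r ^ 2) (by positivity) M
    rw [mul_pow, div_le_iff₀ (by positivity)] at h
    rw [div_mul_eq_mul_div, le_div_iff₀ (by positivity)]
    linarith
  have hone : (1 : ℝ) ≤ Real.exp (c * r ^ 2) := Real.one_le_exp (by positivity)
  rw [Real.exp_neg, ← div_eq_mul_inv, div_le_iff₀ (Real.exp_pos _)]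
  linarith

theorem summable_norm_pow_mul_exp_neg_mul_norm_sq {E : Type*} [NormedAddCommGroup E]
    [NormedSpace ℝ E] [FiniteDimensional ℝ E] (L : Submodule ℤ E) [DiscreteTopology L] (p : ℕ)
    {c : ℝ} (hc : 0 < c) : Summable fun x : L => ‖x‖ ^ p * Real.exp (-(c * ‖x‖ ^ 2)) := by
  set n := Module.finrank ℤ L + 1
  have hsum := (ZLattice.summable_norm_pow_inv L n (Nat.lt_succ_self _)).mul_left
    (1 + ((p + n).factorial : ℝ) / c ^ (p + n))
  refine hsum.of_norm_bounded_eventually ((Set.finite_singleton 0).subset fun x hx => ?_)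
  by_contra hx0
  refine hx ?_
  change ‖‖x‖ ^ p * Real.exp (-(c * ‖x‖ ^ 2))‖ ≤
    (1 + ((p + n).factorial : ℝ) / c ^ (p + n)) * ‖x‖⁻¹ ^ n
  rw [inv_pow, Real.norm_of_nonneg (by positivity), ← div_eq_mul_inv,
    le_div_iff₀ (pow_pos (norm_pos_iff.2 hx0) n)]
  calc _ = ‖x‖ ^ (p + n) * Real.exp (-(c * ‖x‖ ^ 2)) := by ring
    _ ≤ _ := pow_mul_exp_neg_mul_sq_le (p + n) ‖x‖ hc

variable {K : Type*} [Field K] [NumberField K] [Algebra.IsQuadraticExtension ℚ K]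
  [IsTotallyComplex K]

open scoped Classical in
theorem norm_mixedEmbedding_eq_norm (σ : K →+* ℂ) (x : K) : ‖mixedEmbedding K x‖ = ‖σ x‖ := by
  rw [mixedEmbedding.norm_eq_sup'_normAtPlace]
  simp only [mixedEmbedding.normAtPlace_apply, infinitePlace_apply_eq_norm σ, Finset.sup'_const]

theorem summable_fractionalIdeal (σ : K →+* ℂ) (I : (FractionalIdeal (𝓞 K)⁰ K)ˣ) (p : ℕ) {c : ℝ}
    (hc : 0 < c) : Summable fun x : {x : K // x ∈ (I : FractionalIdeal (𝓞 K)⁰ K)} =>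
      ‖σ x‖ ^ p * Real.exp (-(c * ‖σ x‖ ^ 2)) := by
  classical
  let f : {x : K // x ∈ (I : FractionalIdeal (𝓞 K)⁰ K)} → mixedEmbedding.idealLattice K I :=
    fun x => ⟨mixedEmbedding K x, (mixedEmbedding.mem_idealLattice K I).2 ⟨x, x.2, rfl⟩⟩
  have hf : Function.Injective f := fun x y h =>
    Subtype.ext (mixedEmbedding_injective K (Subtype.ext_iff.1 h))
  refine ((summable_norm_pow_mul_exp_neg_mul_norm_sq (mixedEmbedding.idealLattice K I) p
    hc).comp_injective hf).congr fun x => ?_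
  rw [← norm_mixedEmbedding_eq_norm]
  rfl

end Lattice

/-! ### Residues modulo an ideal -/

section Residues

open FractionalIdeal

variable {R : Type*} [CommRing R] [IsDedekindDomain R]
variable {K : Type*} [Field K] [Algebra R K] [IsFractionRing R K] {m : Ideal R}

/-- The congruence `x ≡ y mod 𝔪` for elements of `K` that need not be integral: it is imposed at
the primes dividing `𝔪` only. -/
def CongruentAt (m : Ideal R) (x y : K) : Prop :=
  ∀ v : HeightOneSpectrum R, m ≤ v.asIdeal →
    v.valuation K (x - y) ≤ WithZero.exp (-count K v (m : FractionalIdeal R⁰ K))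

/-- The element `x` of `K` is prime to `𝔪`, that is, a unit at all primes dividing `𝔪`. -/
def IsUnitAt (m : Ideal R) (x : K) : Prop :=
  ∀ v : HeightOneSpectrum R, m ≤ v.asIdeal → v.valuation K x = 1

theorem CongruentAt.symm {x y : K} (h : CongruentAt m x y) : CongruentAt m y x := fun v hv => by
  rw [Valuation.map_sub_swap]
  exact h v hv

theorem CongruentAt.trans {x y z : K} (hxy : CongruentAt m x y) (hyz : CongruentAt m y z) :
    CongruentAt m x z := fun v hv => by
  rw [← sub_add_sub_cancel x y z]
  exact Valuation.map_add_le _ (hxy v hv) (hyz v hv)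

theorem exp_neg_count_lt_one (hm : m ≠ ⊥) {v : HeightOneSpectrum R} (hv : m ≤ v.asIdeal) :
    WithZero.exp (-count K v (m : FractionalIdeal R⁰ K)) < 1 := by
  rw [← WithZero.exp_zero, WithZero.exp_lt_exp, neg_lt_zero]
  exact count_pos_of_le hm hv

theorem IsUnitAt.of_congruentAt (hm : m ≠ ⊥) {x y : K} (hx : IsUnitAt m x)
    (h : CongruentAt m y x) : IsUnitAt m y := fun v hv => by
  rw [← sub_add_cancel y x, Valuation.map_add_eq_of_lt_right, hx v hv]
  rw [hx v hv]
  exact (h v hv).trans_lt (exp_neg_count_lt_one hm hv)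

omit [IsDedekindDomain R] in
theorem exists_heightOneSpectrum_of_sup_ne_top (hm : m ≠ ⊥) {I : Ideal R} (h : I ⊔ m ≠ ⊤) :
    ∃ v : HeightOneSpectrum R, m ≤ v.asIdeal ∧ I ≤ v.asIdeal := by
  obtain ⟨M, hM, hle⟩ := Ideal.exists_le_maximal _ h
  exact ⟨⟨M, hM.isPrime, fun h0 => hm (le_bot_iff.1 (h0 ▸ le_sup_right.trans hle))⟩,
    le_sup_right.trans hle, le_sup_left.trans hle⟩

theorem isUnit_mk_iff (hm : m ≠ ⊥) {z : R} :
    IsUnit (Ideal.Quotient.mk m z) ↔ IsUnitAt m (algebraMap R K z) := by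
  simp only [IsUnitAt, HeightOneSpectrum.valuation_eq_one_iff_notMem]
  constructor
  · intro hz v hv hzv
    have h := hz.map (Ideal.Quotient.factor hv)
    rw [Ideal.Quotient.factor_mk, Ideal.Quotient.eq_zero_iff_mem.2 hzv] at h
    exact not_isUnit_zero h
  · intro hz
    have htop : Ideal.span {z} ⊔ m = ⊤ := by
      by_contra h
      obtain ⟨v, hv, hzv⟩ := exists_heightOneSpectrum_of_sup_ne_top hm h
      exact hz v hv (hzv (Ideal.mem_span_singleton_self z))
    obtain ⟨a, ha, b, hb, hab⟩ := Submodule.mem_sup.1 ((Ideal.eq_top_iff_one _).1 htop)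
    obtain ⟨c, rfl⟩ := Ideal.mem_span_singleton'.1 ha
    refine IsUnit.of_mul_eq_one (Ideal.Quotient.mk m c) ?_
    rw [← map_mul, mul_comm, ← map_one (Ideal.Quotient.mk m), ← hab, map_add,
      Ideal.Quotient.eq_zero_iff_mem.2 hb, add_zero]

theorem algebraMap_mem_coeIdeal_iff {x : R} :
    algebraMap R K x ∈ (m : FractionalIdeal R⁰ K) ↔ x ∈ m := by
  rw [mem_coeIdeal]
  constructor
  · rintro ⟨y, hy, h⟩
    rwa [← FaithfulSMul.algebraMap_injective R K h]
  · exact fun h => ⟨x, h, rfl⟩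

theorem mk_eq_mk_iff (hm : m ≠ ⊥) {y z : R} :
    Ideal.Quotient.mk m y = Ideal.Quotient.mk m z ↔
      CongruentAt m (algebraMap R K y) (algebraMap R K z) := by
  rw [Ideal.Quotient.eq, ← algebraMap_mem_coeIdeal_iff (K := K),
    mem_iff_valuation_le (coeIdeal_ne_zero.2 hm), map_sub]
  refine ⟨fun h v _ => h v, fun h v => ?_⟩
  by_cases hv : m ≤ v.asIdeal
  · exact h v hv
  · rw [count_eq_zero_of_not_le hm hv, neg_zero, WithZero.exp_zero, ← map_sub]
    exact v.valuation_le_one _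

theorem exists_congruentAt_algebraMap (hm : m ≠ ⊥) {y : K}
    (hy : ∀ v : HeightOneSpectrum R, m ≤ v.asIdeal → v.valuation K y ≤ 1) :
    ∃ z : R, CongruentAt m y (algebraMap R K z) := by
  let D : Ideal R := Submodule.comap (LinearMap.toSpanSingleton R K y) (1 : Submodule R K)
  have mem_D (d : R) : d ∈ D ↔ ∃ n : R, algebraMap R K n = algebraMap R K d * y := by
    change LinearMap.toSpanSingleton R K y d ∈ (1 : Submodule R K) ↔ _
    rw [Submodule.mem_one, LinearMap.toSpanSingleton_apply, Algebra.smul_def]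
  have htop : D ⊔ m = ⊤ := by
    by_contra h
    obtain ⟨v, hv, hDv⟩ := exists_heightOneSpectrum_of_sup_ne_top hm h
    obtain ⟨n, d, hd⟩ := v.exists_primeCompl_mul_eq_of_integer y (hy v hv)
    exact d.2 (hDv ((mem_D d).2 ⟨n, by rw [← hd, mul_comm]⟩))
  obtain ⟨d, hd, e, he, hde⟩ := Submodule.mem_sup.1 ((Ideal.eq_top_iff_one _).1 htop)
  obtain ⟨z, hz⟩ := (mem_D d).1 hd
  refine ⟨z, fun v hv => ?_⟩
  have hsub : y - algebraMap R K z = algebraMap R K e * y := by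
    have := congrArg (algebraMap R K) hde
    rw [map_add, map_one] at this
    rw [hz]
    linear_combination (-y) * this
  rw [hsub, map_mul]
  exact mul_le_of_le_of_le_one
    ((mem_iff_valuation_le (coeIdeal_ne_zero.2 hm) _).1 (algebraMap_mem_coeIdeal_iff.2 he) v)
    (hy v hv)

/-- The elements `r μ` of `K^×` are integral representatives of the units `μ` of `R ⧸ 𝔪`. -/
def IsResidueSystem (m : Ideal R) (r : (R ⧸ m)ˣ → Kˣ) : Prop :=
  ∀ μ, ∃ z : R, algebraMap R K z = r μ ∧ Ideal.Quotient.mk m z = μ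

variable {r : (R ⧸ m)ˣ → Kˣ}

theorem IsResidueSystem.isUnitAt (hr : IsResidueSystem m r) (hm : m ≠ ⊥) (μ : (R ⧸ m)ˣ) :
    IsUnitAt m (r μ : K) := by
  obtain ⟨z, hz, hzμ⟩ := hr μ
  rw [← hz, ← isUnit_mk_iff hm, hzμ]
  exact μ.isUnit

theorem IsResidueSystem.existsUnique_congruentAt (hr : IsResidueSystem m r) (hm : m ≠ ⊥) {y : K}
    (hy : IsUnitAt m y) : ∃! μ, CongruentAt m y (r μ) := by
  choose z hz hzμ using hr
  obtain ⟨x, hx⟩ := exists_congruentAt_algebraMap hm fun v hv => (hy v hv).le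
  have hunit : IsUnit (Ideal.Quotient.mk m x) :=
    (isUnit_mk_iff hm).2 (hy.of_congruentAt hm hx.symm)
  have eq_iff (μ : (R ⧸ m)ˣ) : μ = hunit.unit ↔ CongruentAt m (r μ : K) (algebraMap R K x) := by
    rw [← Units.val_inj, IsUnit.unit_spec, ← hzμ, mk_eq_mk_iff hm (K := K), hz]
  exact ⟨hunit.unit, hx.trans ((eq_iff _).1 rfl).symm, fun μ hμ => (eq_iff μ).2 (hμ.symm.trans hx)⟩

end Residues

/-! ### Algebraic Hecke characters -/

section CoprimeIdeles

variable {K : Type*} [Field K] [NumberField K] {m : Ideal (𝓞 K)} (hm : m ≠ ⊥)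
include hm

theorem valued_eq_one_of_mem_coprimeIdeles {t : 𝔸ᶠ[K]ˣ} (ht : t ∈ coprimeIdeles m)
    {v : HeightOneSpectrum (𝓞 K)} (hv : m ≤ v.asIdeal) : Valued.v ((t : 𝔸ᶠ[K]) v) = 1 := by
  have := Valuation.map_one_add_of_lt _
    (((mem_coprimeIdeles_iff hm).1 ht v hv).trans_lt (exp_neg_count_lt_one hm hv))
  rwa [add_sub_cancel] at this

theorem ideleIdeal_mem_coprimeIdeals {t : 𝔸ᶠ[K]ˣ} (ht : t ∈ coprimeIdeles m) :
    ideleIdeal t ∈ coprimeIdeals m := by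
  intro v hv
  rw [count_ideleIdeal, valued_eq_one_of_mem_coprimeIdeles hm ht hv, WithZero.log_one, neg_zero]

theorem one_mem_coprimeIdeles : (1 : 𝔸ᶠ[K]ˣ) ∈ coprimeIdeles m := by
  rw [mem_coprimeIdeles_iff hm]
  intro v _
  have : ((1 : 𝔸ᶠ[K]ˣ) : 𝔸ᶠ[K]) v = 1 := rfl
  rw [this, sub_self, map_zero]
  exact zero_le

theorem mul_inv_mem_coprimeIdeles {s t : 𝔸ᶠ[K]ˣ} (hs : s ∈ coprimeIdeles m)
    (ht : t ∈ coprimeIdeles m) : s * t⁻¹ ∈ coprimeIdeles m := by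
  refine (mem_coprimeIdeles_iff hm).2 fun v hv => ?_
  have ht0 := idele_apply_ne_zero t v
  have hdiv : ((s * t⁻¹ : 𝔸ᶠ[K]ˣ) : 𝔸ᶠ[K]) v - 1 =
      (((s : 𝔸ᶠ[K]) v - 1) - ((t : 𝔸ᶠ[K]) v - 1)) / (t : 𝔸ᶠ[K]) v := by
    rw [idele_mul_apply, idele_inv_apply]
    field_simp
    ring
  rw [hdiv, map_div₀, valued_eq_one_of_mem_coprimeIdeles hm ht hv, div_one]
  exact Valuation.map_sub_le _ ((mem_coprimeIdeles_iff hm).1 hs v hv)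
    ((mem_coprimeIdeles_iff hm).1 ht v hv)

theorem mul_mem_coprimeIdeles {s t : 𝔸ᶠ[K]ˣ} (hs : s ∈ coprimeIdeles m)
    (ht : t ∈ coprimeIdeles m) : s * t ∈ coprimeIdeles m := by
  have := mul_inv_mem_coprimeIdeles hm hs
    (mul_inv_mem_coprimeIdeles hm (one_mem_coprimeIdeles hm) ht)
  rwa [one_mul, inv_inv] at this

theorem unitEmbedding_div_mem_coprimeIdeles {x y : Kˣ} (hx : IsUnitAt m (x : K))
    (hyx : CongruentAt m (y : K) x) :
    FiniteAdeleRing.unitEmbedding (𝓞 K) K (y / x) ∈ coprimeIdeles m := by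
  refine (mem_coprimeIdeles_iff hm).2 fun v hv => ?_
  have hdiv : ((y / x : Kˣ) : K) - 1 = (y - x) / x := by
    rw [Units.val_div_eq_div_val, div_sub_one x.ne_zero]
  rw [unitEmbedding_apply, ← HeightOneSpectrum.adicCompletion.coe_one, ← adicCompletion_coe_sub,
    HeightOneSpectrum.valuedAdicCompletion_eq_valuation', hdiv, map_div₀, hx v hv, div_one]
  exact hyx v hv

end CoprimeIdeles

namespace HeckeCharacter

variable {K : Type*} [Field K] [NumberField K] {m : Ideal (𝓞 K)} {σ : K →+* ℂ} {k : ℕ}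
  (ϱ : HeckeCharacter σ k m)

theorem onIdeal_ne_zero {I : (FractionalIdeal (𝓞 K)⁰ K)ˣ} (hI : I ∈ coprimeIdeals m) :
    ϱ.onIdeal I ≠ 0 := by
  rw [onIdeal, dif_pos hI]
  exact Units.ne_zero _

theorem onIdeal_mul {I : (FractionalIdeal (𝓞 K)⁰ K)ˣ} (hI : I ∈ coprimeIdeals m)
    (J : (FractionalIdeal (𝓞 K)⁰ K)ˣ) : ϱ.onIdeal (I * J) = ϱ.onIdeal I * ϱ.onIdeal J := by
  by_cases hJ : J ∈ coprimeIdeals m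
  · rw [onIdeal, onIdeal, onIdeal, dif_pos hI, dif_pos hJ, dif_pos (mul_mem hI hJ),
      ← Units.val_mul, ← map_mul]
    rfl
  · rw [onIdeal, dif_neg (mt (Subgroup.mul_mem_cancel_left _ hI).1 hJ), onIdeal, onIdeal,
      dif_neg hJ, mul_zero]

theorem onIdeal_mul_inv {I : (FractionalIdeal (𝓞 K)⁰ K)ˣ} (hI : I ∈ coprimeIdeals m)
    (J : (FractionalIdeal (𝓞 K)⁰ K)ˣ) : ϱ.onIdeal (J * I⁻¹) = (ϱ.onIdeal I)⁻¹ * ϱ.onIdeal J := by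
  rw [eq_inv_mul_iff_mul_eq₀ (ϱ.onIdeal_ne_zero hI), ← ϱ.onIdeal_mul hI, mul_comm J,
    mul_inv_cancel_left]

variable (hm : m ≠ ⊥)
include hm

theorem onIdeal_toPrincipalIdeal {α : Kˣ}
    (hα : FiniteAdeleRing.unitEmbedding (𝓞 K) K α ∈ coprimeIdeles m) :
    ϱ.onIdeal (toPrincipalIdeal (𝓞 K) K α) = σ α ^ (k - 1) := by
  have h := ideleIdeal_mem_coprimeIdeals hm hα
  rw [ideleIdeal_unitEmbedding] at h
  rw [onIdeal, dif_pos h]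
  exact ϱ.map_principal α h hα

theorem onIdele_eq {t : 𝔸ᶠ[K]ˣ} {α : Kˣ}
    (hα : FiniteAdeleRing.unitEmbedding (𝓞 K) K α * t ∈ coprimeIdeles m) :
    ϱ.onIdele t = (σ α ^ (k - 1))⁻¹ *
      ϱ.onIdeal (ideleIdeal (FiniteAdeleRing.unitEmbedding (𝓞 K) K α * t)) := by
  have H : ∃ α : Kˣ, FiniteAdeleRing.unitEmbedding (𝓞 K) K α * t ∈ coprimeIdeles m := ⟨α, hα⟩
  rw [onIdele, dif_pos H]
  have hβ := H.choose_spec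
  set β := H.choose
  have hβα : FiniteAdeleRing.unitEmbedding (𝓞 K) K (β / α) ∈ coprimeIdeles m := by
    have := mul_inv_mem_coprimeIdeles hm hβ hα
    rwa [← div_eq_mul_inv, mul_div_mul_right_eq_div, ← map_div] at this
  have hideal : FiniteAdeleRing.unitEmbedding (𝓞 K) K β * t =
      FiniteAdeleRing.unitEmbedding (𝓞 K) K α * t *
        FiniteAdeleRing.unitEmbedding (𝓞 K) K (β / α) := by
    rw [mul_right_comm, ← map_mul, mul_div_cancel]
  rw [hideal, ideleIdeal_mul, ideleIdeal_unitEmbedding,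
    ϱ.onIdeal_mul (ideleIdeal_mem_coprimeIdeals hm hα), ϱ.onIdeal_toPrincipalIdeal hm hβα,
    Units.val_div_eq_div_val, map_div₀, div_pow]
  have hα0 : σ α ≠ 0 := (map_ne_zero σ).2 α.ne_zero
  have hβ0 : σ β ≠ 0 := (map_ne_zero σ).2 β.ne_zero
  field_simp

theorem onIdele_of_mem {t : 𝔸ᶠ[K]ˣ} (ht : t ∈ coprimeIdeles m) :
    ϱ.onIdele t = ϱ.onIdeal (ideleIdeal t) := by
  have h := ϱ.onIdele_eq hm (t := t) (α := 1) (by rwa [map_one, one_mul])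
  simpa using h

theorem onIdeal_toPrincipalIdeal_eq_eta_mul {x y : Kˣ} (hx : IsUnitAt m (x : K))
    (hyx : CongruentAt m (y : K) x) :
    ϱ.onIdeal (toPrincipalIdeal (𝓞 K) K y) = ϱ.eta x * σ y ^ (k - 1) := by
  have hdiv := unitEmbedding_div_mem_coprimeIdeles hm hx hyx
  have hmem := ideleIdeal_mem_coprimeIdeals hm hdiv
  rw [ideleIdeal_unitEmbedding] at hmem
  rw [← div_mul_cancel y x, map_mul, ϱ.onIdeal_mul hmem, ϱ.onIdeal_toPrincipalIdeal hm hdiv, eta,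
    div_mul_cancel, Units.val_div_eq_div_val, map_div₀, div_pow]
  ring

variable [Fintype (𝓞 K ⧸ m)ˣ] {r : (𝓞 K ⧸ m)ˣ → Kˣ} (hr : IsResidueSystem m r)
include hr

open Classical in
theorem sum_eta_mul_pow (y : Kˣ) :
    (∑ μ with CongruentAt m (y : K) (r μ), ϱ.eta (r μ)) * σ y ^ (k - 1) =
      ϱ.onIdeal (toPrincipalIdeal (𝓞 K) K y) := by
  by_cases hy : IsUnitAt m (y : K)
  · obtain ⟨μ, hμ, huniq⟩ := hr.existsUnique_congruentAt hm hy
    have hfilter : ({ν | CongruentAt m (y : K) (r ν)} : Finset _) = {μ} := by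
      ext ν
      simp only [Finset.mem_filter_univ, Finset.mem_singleton]
      exact ⟨huniq ν, fun h => h ▸ hμ⟩
    rw [hfilter, Finset.sum_singleton,
      ϱ.onIdeal_toPrincipalIdeal_eq_eta_mul hm (hr.isUnitAt hm μ) hμ]
  · have hfilter : ({ν | CongruentAt m (y : K) (r ν)} : Finset _) = ∅ :=
      Finset.filter_eq_empty_iff.2 fun μ _ hμ => hy ((hr.isUnitAt hm μ).of_congruentAt hm hμ)
    have hcoprime : toPrincipalIdeal (𝓞 K) K y ∉ coprimeIdeals m := fun h => hy fun v hv => by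
      rw [valuation_eq_exp_neg_count v y.ne_zero, ← coe_toPrincipalIdeal, h v hv, neg_zero,
        WithZero.exp_zero]
    rw [hfilter, Finset.sum_empty, zero_mul, onIdeal, dif_neg hcoprime]

open Classical in
theorem sum_eta_mul_zero_pow (hk : 1 ≤ k) :
    (∑ μ with CongruentAt m (0 : K) (r μ), ϱ.eta (r μ)) * 0 ^ (k - 1) =
      if k = 1 ∧ m = ⊤ then 1 else 0 := by
  rcases hk.eq_or_lt with rfl | hk1
  swap
  · rw [zero_pow (by lia), mul_zero, if_neg fun h => hk1.ne' h.1]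
  rw [Nat.sub_self, pow_zero, mul_one]
  by_cases hmt : m = ⊤
  · have hno (v : HeightOneSpectrum (𝓞 K)) : ¬ m ≤ v.asIdeal := fun hv =>
      v.isPrime.ne_top (top_le_iff.1 (hmt ▸ hv))
    have : Subsingleton (𝓞 K ⧸ m) := Ideal.Quotient.subsingleton_iff.2 hmt
    have : Unique (𝓞 K ⧸ m)ˣ := ⟨⟨1⟩, fun a => Subsingleton.elim _ _⟩
    rw [if_pos ⟨rfl, hmt⟩, Finset.filter_true_of_mem fun μ _ v hv => (hno v hv).elim,
      Fintype.sum_unique, eta, ϱ.onIdeal_toPrincipalIdeal hm fun v hv => (hno v hv).elim]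
    simp
  · obtain ⟨v, hv, -⟩ := exists_heightOneSpectrum_of_sup_ne_top hm (I := ⊥) (by rwa [bot_sup_eq])
    rw [if_neg fun h => hmt h.2, Finset.filter_false_of_mem, Finset.sum_empty]
    intro μ _ hμ
    have := (hr.isUnitAt hm μ).of_congruentAt hm hμ v hv
    rw [map_zero] at this
    exact zero_ne_one this

end HeckeCharacter

/-! ### Compactness of the integral ideles -/

section ResidueField

variable {R : Type*} [CommRing R] [IsDedekindDomain R]
variable {K : Type*} [Field K] [Algebra R K] [IsFractionRing R K]

theorem residue_eq_zero_iff_valued_lt_one {v : HeightOneSpectrum R}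
    {x : v.adicCompletionIntegers K} : IsLocalRing.residue _ x = 0 ↔ Valued.v x.1 < 1 := by
  rw [IsLocalRing.residue_eq_zero_iff, IsLocalRing.mem_maximalIdeal, mem_nonunits_iff,
    HeightOneSpectrum.adicCompletionIntegers.isUnit_iff_valued_eq_one, ← ne_eq]
  exact ⟨lt_of_le_of_ne x.2, ne_of_lt⟩

variable (K) in
theorem residue_comp_algebraMap_surjective (v : HeightOneSpectrum R) :
    Function.Surjective ((IsLocalRing.residue _).comp
      (algebraMap R (v.adicCompletionIntegers K))) := by
  intro y
  obtain ⟨x, rfl⟩ := IsLocalRing.residue_surjective y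
  obtain ⟨a, ha⟩ := exists_valued_sub_le v (x : v.adicCompletion K) (-1)
  have hexp : WithZero.exp (-1 : ℤ) < (1 : WithZero (Multiplicative ℤ)) := by
    rw [← WithZero.exp_zero, WithZero.exp_lt_exp]
    norm_num
  have ha1 : v.valuation K a ≤ 1 := by
    rw [← HeightOneSpectrum.valuedAdicCompletion_eq_valuation',
      ← sub_add_cancel (a : v.adicCompletion K) x.1]
    exact Valuation.map_add_le _ (ha.trans hexp.le) x.2
  obtain ⟨b, hb⟩ := HeightOneSpectrum.exists_valuation_sub_lt_of_integer v ha1 1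
  refine ⟨b, ?_⟩
  rw [RingHom.comp_apply, ← sub_eq_zero, ← map_sub, residue_eq_zero_iff_valued_lt_one]
  have hsub : (algebraMap R (v.adicCompletionIntegers K) b - x).1 =
      ((algebraMap R K b - a : K) : v.adicCompletion K) + ((a : v.adicCompletion K) - x) := by
    rw [adicCompletion_coe_sub, sub_add_sub_cancel]
    rfl
  rw [hsub]
  refine Valuation.map_add_lt _ ?_ (ha.trans_lt hexp)
  rw [HeightOneSpectrum.valuedAdicCompletion_eq_valuation']
  simpa using hb

instance finite_residueField_adicCompletionIntegers (v : HeightOneSpectrum R)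
    [Finite (R ⧸ v.asIdeal)] :
    Finite (IsLocalRing.ResidueField (v.adicCompletionIntegers K)) := by
  refine Finite.of_surjective (Ideal.Quotient.lift v.asIdeal _ fun a ha => ?_)
    (Ideal.Quotient.lift_surjective_of_surjective _ _ (residue_comp_algebraMap_surjective K v))
  rw [RingHom.comp_apply, residue_eq_zero_iff_valued_lt_one,
    HeightOneSpectrum.algebraMap_adicCompletionIntegers_apply,
    HeightOneSpectrum.valuedAdicCompletion_eq_valuation']
  exact (HeightOneSpectrum.valuation_lt_one_iff_mem _ _).2 ha

end ResidueField

section IntegralUnits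

variable {K : Type*} [Field K] [NumberField K]

open Valued.integer in
instance compactSpace_adicCompletionIntegers (v : HeightOneSpectrum (𝓞 K)) :
    CompactSpace (v.adicCompletionIntegers K) := by
  have hclosed : IsClosed (v.adicCompletionIntegers K : Set (v.adicCompletion K)) :=
    Valued.isClosed_valuationSubring _
  have : Finite (𝓞 K ⧸ v.asIdeal) := v.asIdeal.finiteQuotientOfFreeOfNeBot v.ne_bot
  refine (compactSpace_iff_completeSpace_and_isDiscreteValuationRing_and_finite_residueField
    (K := v.adicCompletion K)).2 ⟨hclosed.completeSpace_coe, ?_, ?_⟩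
  · exact inferInstanceAs (IsDiscreteValuationRing (v.adicCompletionIntegers K))
  · exact inferInstanceAs (Finite (IsLocalRing.ResidueField (v.adicCompletionIntegers K)))

variable (K)

/-- The embedding of `Ô_K = ∏ᵥ O_v` into the finite adeles. -/
def integralAdeles : (Π v : HeightOneSpectrum (𝓞 K), v.adicCompletionIntegers K) →* 𝔸ᶠ[K] where
  toFun := RestrictedProduct.structureMap _ _ _
  map_one' := rfl
  map_mul' _ _ := rfl

theorem range_units_map_integralAdeles :
    (Units.map (integralAdeles K)).range = integralUnits K := by
  ext u
  constructor
  · rintro ⟨w, rfl⟩ v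
    exact HeightOneSpectrum.adicCompletionIntegers.isUnit_iff_valued_eq_one.1
      (Pi.isUnit_iff.1 w.isUnit v)
  · intro hu
    have hinv := inv_mem hu
    refine ⟨⟨fun v => ⟨_, (hu v).le⟩, fun v => ⟨_, (hinv v).le⟩, ?_, ?_⟩, Units.ext rfl⟩ <;>
    funext v <;> apply Subtype.ext
    · exact congrArg (fun x : 𝔸ᶠ[K] => x v) u.mul_inv
    · exact congrArg (fun x : 𝔸ᶠ[K] => x v) u.inv_mul

theorem isCompact_integralUnits : IsCompact (integralUnits K : Set 𝔸ᶠ[K]ˣ) := by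
  rw [← range_units_map_integralAdeles, MonoidHom.coe_range]
  exact isCompact_range
    (Continuous.units_map _ RestrictedProduct.isEmbedding_structureMap.continuous)

variable {K} in
theorem relIndex_integralUnits_ne_zero {Kf : Subgroup 𝔸ᶠ[K]ˣ}
    (h : IsOpen (Kf : Set 𝔸ᶠ[K]ˣ)) : Kf.relIndex (integralUnits K) ≠ 0 := by
  have : CompactSpace (integralUnits K) :=
    isCompact_iff_compactSpace.1 (isCompact_integralUnits K)
  have : Finite (integralUnits K ⧸ Kf.subgroupOf (integralUnits K)) :=
    Subgroup.quotient_finite_of_isOpen _ (Subgroup.subgroupOf_isOpen _ _ h)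
  exact Subgroup.index_ne_zero_of_finite

end IntegralUnits

/-! ### Unfolding the theta series -/

section Cosets

variable {F Γ : Type*} [Field F] [LinearOrderedCommGroupWithZero Γ] (v : Valuation F Γ)

theorem valuation_le_iff_of_sub_le {a b : F} {γ : Γ} (h : v (a - b) ≤ γ) : v a ≤ γ ↔ v b ≤ γ := by
  constructor
  · intro ha
    rw [← sub_sub_cancel a b]
    exact Valuation.map_sub_le _ ha h
  · intro hb
    rw [← sub_add_cancel a b]
    exact Valuation.map_add_le _ h hb

theorem valuation_inv_mul_sub_le_iff {u x r : F} {γ : Γ} (hu : u ≠ 0) (hr : v r ≤ γ) :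
    v (u⁻¹ * x - r) ≤ γ ↔ v x ≤ v u * γ := by
  rw [valuation_le_iff_of_sub_le v (b := u⁻¹ * x) (by rwa [sub_sub_cancel_left, Valuation.map_neg]),
    map_mul, map_inv₀, inv_mul_le_iff₀ (zero_lt_iff.2 ((Valuation.ne_zero_iff v).2 hu))]

theorem valuation_inv_mul_sub_le_iff_of_sub_one_le {u x r : F} {γ : Γ} (hu : v u = 1)
    (hu' : v (u - 1) ≤ γ) (hr : v r ≤ 1) : v (u⁻¹ * x - r) ≤ γ ↔ v (x - r) ≤ γ := by
  have hu0 : u ≠ 0 := (Valuation.ne_zero_iff v).1 (by rw [hu]; exact one_ne_zero)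
  have hdiv : u⁻¹ * x - r = (x - u * r) / u := by field_simp
  rw [hdiv, map_div₀, hu, div_one]
  refine valuation_le_iff_of_sub_le v ?_
  rw [show x - u * r - (x - r) = -((u - 1) * r) by ring, Valuation.map_neg, map_mul]
  exact mul_le_of_le_of_le_one hu' hr

variable {K : Type*} [Field K] [NumberField K]

theorem mem_hat_iff {P : FractionalIdeal (𝓞 K)⁰ K} (hP : P ≠ 0) (x : 𝔸ᶠ[K]) :
    x ∈ hat P ↔ ∀ v, Valued.v (x v) ≤ WithZero.exp (-FractionalIdeal.count K v P) :=
  forall_congr' fun v => mem_localIdeal_iff v hP (x v)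

theorem inv_mul_sub_apply (u : 𝔸ᶠ[K]ˣ) (x r : K) (v : HeightOneSpectrum (𝓞 K)) :
    ((u⁻¹ : 𝔸ᶠ[K]ˣ) * algebraMap K 𝔸ᶠ[K] x - algebraMap K 𝔸ᶠ[K] r) v =
      ((u : 𝔸ᶠ[K]) v)⁻¹ * (x : v.adicCompletion K) - (r : v.adicCompletion K) := by
  rw [← idele_inv_apply]
  rfl

theorem exp_neg_count_ideleIdeal (t : 𝔸ᶠ[K]ˣ) (v : HeightOneSpectrum (𝓞 K)) :
    WithZero.exp (-FractionalIdeal.count K v (ideleIdeal t : FractionalIdeal (𝓞 K)⁰ K)) =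
      Valued.v ((t : 𝔸ᶠ[K]) v) :=
  (valued_idele t v).symm

theorem mem_ideleIdeal_iff (t : 𝔸ᶠ[K]ˣ) (x : K) :
    x ∈ (ideleIdeal t : FractionalIdeal (𝓞 K)⁰ K) ↔
      ∀ v : HeightOneSpectrum (𝓞 K),
        Valued.v (x : v.adicCompletion K) ≤ Valued.v ((t : 𝔸ᶠ[K]) v) := by
  simp_rw [mem_iff_valuation_le (Units.ne_zero (ideleIdeal t)), exp_neg_count_ideleIdeal,
    HeightOneSpectrum.valuedAdicCompletion_eq_valuation']

variable {m : Ideal (𝓞 K)} (hm : m ≠ ⊥)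
include hm

theorem mem_hat_coeIdeal_mul_ideleIdeal_iff (t : 𝔸ᶠ[K]ˣ) (x : 𝔸ᶠ[K]) :
    x ∈ hat ((m : FractionalIdeal (𝓞 K)⁰ K) * (ideleIdeal t : FractionalIdeal (𝓞 K)⁰ K)) ↔
      ∀ v, Valued.v (x v) ≤
        WithZero.exp (-FractionalIdeal.count K v (m : FractionalIdeal (𝓞 K)⁰ K)) *
          Valued.v ((t : 𝔸ᶠ[K]) v) := by
  have hm' : (m : FractionalIdeal (𝓞 K)⁰ K) ≠ 0 := FractionalIdeal.coeIdeal_ne_zero.2 hm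
  simp_rw [mem_hat_iff (mul_ne_zero hm' (Units.ne_zero _)),
    FractionalIdeal.count_mul K _ hm' (Units.ne_zero _), neg_add, WithZero.exp_add,
    exp_neg_count_ideleIdeal]

theorem mem_of_inv_mul_sub_mem_hat {s t : 𝔸ᶠ[K]ˣ} {x r : K}
    (hr : r ∈ (ideleIdeal t : FractionalIdeal (𝓞 K)⁰ K))
    (hx : (s⁻¹ : 𝔸ᶠ[K]ˣ) * algebraMap K 𝔸ᶠ[K] x - algebraMap K 𝔸ᶠ[K] r ∈
      hat ((m : FractionalIdeal (𝓞 K)⁰ K) * (ideleIdeal t : FractionalIdeal (𝓞 K)⁰ K))) :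
    x ∈ (ideleIdeal (s * t) : FractionalIdeal (𝓞 K)⁰ K) := by
  rw [mem_ideleIdeal_iff] at hr ⊢
  intro v
  rw [idele_mul_apply, map_mul,
    ← valuation_inv_mul_sub_le_iff _ (idele_apply_ne_zero s v) (hr v), ← inv_mul_sub_apply]
  refine ((mem_hat_coeIdeal_mul_ideleIdeal_iff hm t _).1 hx v).trans (mul_le_of_le_one_left' ?_)
  rw [← WithZero.exp_zero, WithZero.exp_le_exp, neg_nonpos]
  exact FractionalIdeal.count_coe_nonneg K v m

theorem inv_mul_sub_mem_hat_iff {u t : 𝔸ᶠ[K]ˣ} (ht : t ∈ coprimeIdeles m)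
    (hu : u ∈ coprimeIdeles m) {r : K} (hr : r ∈ (ideleIdeal t : FractionalIdeal (𝓞 K)⁰ K))
    (x : K) :
    (u⁻¹ : 𝔸ᶠ[K]ˣ) * algebraMap K 𝔸ᶠ[K] x - algebraMap K 𝔸ᶠ[K] r ∈
        hat ((m : FractionalIdeal (𝓞 K)⁰ K) * (ideleIdeal t : FractionalIdeal (𝓞 K)⁰ K)) ↔
      x ∈ (ideleIdeal (u * t) : FractionalIdeal (𝓞 K)⁰ K) ∧ CongruentAt m x r := by
  rw [mem_ideleIdeal_iff] at hr
  rw [mem_hat_coeIdeal_mul_ideleIdeal_iff hm, mem_ideleIdeal_iff, CongruentAt, ← forall_and]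
  refine forall_congr' fun v => ?_
  rw [inv_mul_sub_apply, idele_mul_apply, map_mul,
    ← valuation_inv_mul_sub_le_iff _ (idele_apply_ne_zero u v) (hr v)]
  by_cases hv : m ≤ v.asIdeal
  · have hlt := exp_neg_count_lt_one (K := K) hm hv
    have ht1 := valued_eq_one_of_mem_coprimeIdeles hm ht hv
    have hiff := valuation_inv_mul_sub_le_iff_of_sub_one_le Valued.v (x := (x : v.adicCompletion K))
      (valued_eq_one_of_mem_coprimeIdeles hm hu hv) ((mem_coprimeIdeles_iff hm).1 hu v hv)
      ((hr v).trans ht1.le)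
    rw [ht1, mul_one, hiff, ← adicCompletion_coe_sub,
      HeightOneSpectrum.valuedAdicCompletion_eq_valuation']
    refine ⟨fun h => ⟨?_, fun _ => h⟩, fun h => h.2 hv⟩
    rw [← HeightOneSpectrum.valuedAdicCompletion_eq_valuation', adicCompletion_coe_sub] at h
    exact (hiff.2 h).trans hlt.le
  · simp only [hv, false_implies, and_true, count_eq_zero_of_not_le hm hv, neg_zero,
      WithZero.exp_zero, one_mul]

end Cosets

section CosetIndicator

variable {K : Type*} [Field K] [NumberField K]

theorem inv_mul_algebraMap_inv_mul (s : 𝔸ᶠ[K]ˣ) (α : Kˣ) (y : K) :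
    (s⁻¹ : 𝔸ᶠ[K]ˣ) * algebraMap K 𝔸ᶠ[K] ((α : K)⁻¹ * y) =
      ((FiniteAdeleRing.unitEmbedding (𝓞 K) K α * s)⁻¹ : 𝔸ᶠ[K]ˣ) * algebraMap K 𝔸ᶠ[K] y := by
  rw [mul_inv, ← map_inv, Units.val_mul, map_mul, ← Units.val_inv_eq_inv_val, mul_left_comm,
    mul_assoc]
  rfl

theorem norm_cosetIndicator_le (P : FractionalIdeal (𝓞 K)⁰ K) (r : K) (x : 𝔸ᶠ[K]) :
    ‖cosetIndicator P r x‖ ≤ 1 := by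
  classical
  rw [cosetIndicator, Set.indicator_apply]
  split_ifs <;> simp

theorem cosetIndicator_ne_zero_iff {P : FractionalIdeal (𝓞 K)⁰ K} {r : K} {x : 𝔸ᶠ[K]} :
    cosetIndicator P r x ≠ 0 ↔ x - algebraMap K 𝔸ᶠ[K] r ∈ hat P := by
  rw [cosetIndicator, Set.indicator_apply_ne_zero, Function.support_one, Set.inter_univ]
  rfl

theorem absNorm_toPrincipalIdeal [Algebra.IsQuadraticExtension ℚ K] [IsTotallyComplex K] (α : Kˣ) :
    FractionalIdeal.absNorm (toPrincipalIdeal (𝓞 K) K α : FractionalIdeal (𝓞 K)⁰ K) =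
      Algebra.norm ℚ (α : K) := by
  rw [coe_toPrincipalIdeal, FractionalIdeal.absNorm_span_singleton,
    abs_of_nonneg (algebraNorm_nonneg _)]

end CosetIndicator

namespace HeckeCharacter

variable {K : Type*} [Field K] [NumberField K] {m : Ideal (𝓞 K)} {σ : K →+* ℂ} {k : ℕ}
  (ϱ : HeckeCharacter σ k m)

/-- The term `ϱ(I) q^{Nm I}` for a fractional ideal `I`, not necessarily integral. -/
def fracTerm (τ : ℍ) (I : (FractionalIdeal (𝓞 K)⁰ K)ˣ) : ℂ :=
  ϱ.onIdeal I * Complex.exp (2 * Real.pi * Complex.I * τ *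
    ((FractionalIdeal.absNorm (I : FractionalIdeal (𝓞 K)⁰ K) : ℚ) : ℂ))

open Classical in
/-- The term `ϱ(yB⁻¹) q^{Nm(yB⁻¹)}` for a nonzero element `y` of a fractional ideal `B`, extended
by zero to `K`. -/
def classTerm (τ : ℍ) (B : (FractionalIdeal (𝓞 K)⁰ K)ˣ) (y : K) : ℂ :=
  if hy : y ≠ 0 ∧ y ∈ (B : FractionalIdeal (𝓞 K)⁰ K) then
    ϱ.fracTerm τ (toPrincipalIdeal (𝓞 K) K (Units.mk0 y hy.1) * B⁻¹) else 0

open Classical in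
/-- The contribution of `y = 0` to the theta series attached to a fractional ideal `B`. -/
def constTerm (B : (FractionalIdeal (𝓞 K)⁰ K)ˣ) : ℂ :=
  if k = 1 ∧ m = ⊤ then (ϱ.onIdeal B)⁻¹ else 0

variable [Algebra.IsQuadraticExtension ℚ K] [IsTotallyComplex K]

/-- The term at `x` of `ϱ(t)⁻¹ η(r) ϱ(h/h̄)⁻¹ θ_{P+r}(τ, h)`, where `P` is the lattice
`(𝔪𝔞, Nm(𝔞)⁻¹ Nm)` for the ideal `𝔞` of `t`. -/
def twistedTerm (t h : 𝔸ᶠ[K]ˣ) (r : Kˣ) (τ : ℍ) (x : K) : ℂ :=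
  (ϱ.onIdele t)⁻¹ * ϱ.eta r * ((ϱ.onIdele (normMinus K h))⁻¹ *
    thetaTerm σ k (FractionalIdeal.absNorm (ideleIdeal t : FractionalIdeal (𝓞 K)⁰ K))⁻¹
      (cosetIndicator ((m : FractionalIdeal (𝓞 K)⁰ K) *
        (ideleIdeal t : FractionalIdeal (𝓞 K)⁰ K)) r) h τ x)

omit [Algebra.IsQuadraticExtension ℚ K] [IsTotallyComplex K] in
theorem fracTerm_mk0 (τ : ℍ) (a : (Ideal (𝓞 K))⁰) :
    ϱ.fracTerm τ (FractionalIdeal.mk0 K a) = ϱ.formTerm τ a := by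
  rw [fracTerm, formTerm, FractionalIdeal.coe_mk0, FractionalIdeal.coeIdeal_absNorm]
  norm_cast

theorem classTerm_of_ne_zero {B : (FractionalIdeal (𝓞 K)⁰ K)ˣ} (hB : B ∈ coprimeIdeals m) (τ : ℍ)
    {y : Kˣ} (hy : (y : K) ∈ (B : FractionalIdeal (𝓞 K)⁰ K)) :
    ϱ.classTerm τ B y = (ϱ.onIdeal B)⁻¹ * ϱ.onIdeal (toPrincipalIdeal (𝓞 K) K y) *
      Complex.exp (2 * Real.pi * Complex.I * τ * (((FractionalIdeal.absNorm
        (B : FractionalIdeal (𝓞 K)⁰ K))⁻¹ * Algebra.norm ℚ (y : K) : ℚ) : ℂ)) := by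
  rw [classTerm, dif_pos ⟨y.ne_zero, hy⟩, Units.mk0_val, fracTerm, ϱ.onIdeal_mul_inv hB,
    Units.val_mul, map_mul, absNorm_toPrincipalIdeal, Units.val_inv_eq_inv_val, map_inv₀,
    mul_comm (Algebra.norm ℚ (y : K))]

/-- Since `Nm(h/h̄) = 1`, the norm form of the lattice of `t` and that of the lattice of
`α (h/h̄) t` correspond to each other under multiplication by `α`. -/
theorem inv_absNorm_mul_norm_inv_mul (t h : 𝔸ᶠ[K]ˣ) (α : Kˣ) (y : K) :
    (FractionalIdeal.absNorm (ideleIdeal t : FractionalIdeal (𝓞 K)⁰ K))⁻¹ *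
        Algebra.norm ℚ ((α : K)⁻¹ * y) =
      (FractionalIdeal.absNorm (ideleIdeal (FiniteAdeleRing.unitEmbedding (𝓞 K) K α *
        normMinus K h * t) : FractionalIdeal (𝓞 K)⁰ K))⁻¹ * Algebra.norm ℚ y := by
  simp only [ideleIdeal_mul, Units.val_mul, map_mul, absNorm_ideleIdeal_normMinus, mul_one,
    ideleIdeal_unitEmbedding, absNorm_toPrincipalIdeal, Algebra.norm_inv, mul_inv]
  ring

variable (hm : m ≠ ⊥) {t h : 𝔸ᶠ[K]ˣ} {α : Kˣ} (ht : t ∈ coprimeIdeles m)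
  (hα : FiniteAdeleRing.unitEmbedding (𝓞 K) K α * normMinus K h ∈ coprimeIdeles m)
include hm ht hα

open Classical in
theorem twistedTerm_inv_mul {r : Kˣ} (hr : (r : K) ∈ (ideleIdeal t : FractionalIdeal (𝓞 K)⁰ K))
    (τ : ℍ) (y : K) {B : (FractionalIdeal (𝓞 K)⁰ K)ˣ}
    (hB : B = ideleIdeal (FiniteAdeleRing.unitEmbedding (𝓞 K) K α * normMinus K h * t)) :
    ϱ.twistedTerm t h r τ ((α : K)⁻¹ * y) =
      if y ∈ (B : FractionalIdeal (𝓞 K)⁰ K) then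
        (ϱ.onIdeal B)⁻¹ * ((if CongruentAt m y r then ϱ.eta r else 0) * σ y ^ (k - 1)) *
          Complex.exp (2 * Real.pi * Complex.I * τ * (((FractionalIdeal.absNorm
            (B : FractionalIdeal (𝓞 K)⁰ K))⁻¹ * Algebra.norm ℚ y : ℚ) : ℂ))
      else 0 := by
  have hindicator : cosetIndicator ((m : FractionalIdeal (𝓞 K)⁰ K) *
      (ideleIdeal t : FractionalIdeal (𝓞 K)⁰ K)) r
        (((normMinus K h)⁻¹ : 𝔸ᶠ[K]ˣ) * algebraMap K 𝔸ᶠ[K] ((α : K)⁻¹ * y)) =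
      if y ∈ (B : FractionalIdeal (𝓞 K)⁰ K) ∧ CongruentAt m y r then 1 else 0 := by
    rw [cosetIndicator, Set.indicator_apply, inv_mul_algebraMap_inv_mul, hB]
    exact if_congr (inv_mul_sub_mem_hat_iff hm ht hα hr y) rfl rfl
  have hval : ϱ.onIdeal B = ϱ.onIdeal (ideleIdeal t) *
      ϱ.onIdeal (ideleIdeal (FiniteAdeleRing.unitEmbedding (𝓞 K) K α * normMinus K h)) := by
    rw [hB, mul_comm, ideleIdeal_mul, ϱ.onIdeal_mul (ideleIdeal_mem_coprimeIdeals hm ht)]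
  have hα0 : σ α ≠ 0 := (map_ne_zero σ).2 α.ne_zero
  rw [twistedTerm, thetaTerm, inv_absNorm_mul_norm_inv_mul, ← hB, hindicator,
    ϱ.onIdele_of_mem hm ht, ϱ.onIdele_eq hm hα, hval, ite_and, map_mul, map_inv₀, mul_pow,
    inv_pow]
  split_ifs
  · field_simp
  · simp only [mul_zero, zero_mul]
  · simp only [mul_zero, zero_mul]

open Classical in
theorem sum_twistedTerm_inv_mul [Fintype (𝓞 K ⧸ m)ˣ] (hk : 1 ≤ k) {r : (𝓞 K ⧸ m)ˣ → Kˣ}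
    (hrt : ∀ μ, (r μ : K) ∈ (ideleIdeal t : FractionalIdeal (𝓞 K)⁰ K))
    (hr : IsResidueSystem m r) (τ : ℍ) (y : K) {B : (FractionalIdeal (𝓞 K)⁰ K)ˣ}
    (hB : B = ideleIdeal (FiniteAdeleRing.unitEmbedding (𝓞 K) K α * normMinus K h * t)) :
    ∑ μ, ϱ.twistedTerm t h (r μ) τ ((α : K)⁻¹ * y) =
      ϱ.classTerm τ B y + if y = 0 then ϱ.constTerm B else 0 := by
  have hBm : B ∈ coprimeIdeals m :=
    hB ▸ ideleIdeal_mem_coprimeIdeals hm (mul_mem_coprimeIdeles hm hα ht)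
  simp_rw [fun μ => ϱ.twistedTerm_inv_mul hm ht hα (hrt μ) τ y hB]
  by_cases hyB : y ∈ (B : FractionalIdeal (𝓞 K)⁰ K)
  · simp_rw [if_pos hyB]
    rw [← Finset.sum_mul, ← Finset.mul_sum, ← Finset.sum_mul, ← Finset.sum_filter]
    rcases eq_or_ne y 0 with rfl | hy
    · rw [map_zero, ϱ.sum_eta_mul_zero_pow hm hr hk, classTerm, dif_neg fun h => h.1 rfl, zero_add,
        if_pos rfl, constTerm, Algebra.norm_zero]
      simp
    · lift y to Kˣ using isUnit_iff_ne_zero.2 hy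
      rw [ϱ.sum_eta_mul_pow hm hr, ϱ.classTerm_of_ne_zero hBm τ hyB, if_neg hy,
        add_zero]
  · have hy : y ≠ 0 := fun h => hyB (h ▸ FractionalIdeal.zero_mem _)
    simp_rw [if_neg hyB]
    rw [Finset.sum_const_zero, classTerm, dif_neg fun h => hyB h.2, if_neg hy, zero_add]

end HeckeCharacter

section Convergence

variable {K : Type*} [Field K] [NumberField K] [Algebra.IsQuadraticExtension ℚ K]
  [IsTotallyComplex K] {σ : K →+* ℂ} {k : ℕ}

theorem norm_thetaTerm (a : ℚ) (φ : 𝔸ᶠ[K] → ℂ) (h : 𝔸ᶠ[K]ˣ) (τ : ℍ) (x : K) :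
    ‖thetaTerm σ k a φ h τ x‖ = ‖φ (((normMinus K h)⁻¹ : 𝔸ᶠ[K]ˣ) * algebraMap K _ x)‖ *
      (‖σ x‖ ^ (k - 1) * Real.exp (-(2 * Real.pi * τ.im * (a : ℝ) * ‖σ x‖ ^ 2))) := by
  have hre : (2 * Real.pi * Complex.I * τ * ((a * Algebra.norm ℚ x : ℚ) : ℂ)).re =
      -(2 * Real.pi * τ.im * (a : ℝ) * ‖σ x‖ ^ 2) := by
    rw [← algebraNorm_eq_norm_sq σ x, ← Complex.ofReal_ratCast, Complex.re_mul_ofReal]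
    simp [Complex.mul_re, Complex.mul_im]
    ring
  rw [thetaTerm, norm_mul, norm_mul, norm_pow, Complex.norm_exp, mul_assoc, hre]

theorem summable_thetaTerm_of_support {a : ℚ} (ha : 0 < a) {φ : 𝔸ᶠ[K] → ℂ} (hφ : ∀ x, ‖φ x‖ ≤ 1)
    (h : 𝔸ᶠ[K]ˣ) (I : (FractionalIdeal (𝓞 K)⁰ K)ˣ)
    (hI : ∀ x : K, φ (((normMinus K h)⁻¹ : 𝔸ᶠ[K]ˣ) * algebraMap K _ x) ≠ 0 →
      x ∈ (I : FractionalIdeal (𝓞 K)⁰ K)) (τ : ℍ) : Summable (thetaTerm σ k a φ h τ) := by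
  have hc : 0 < 2 * Real.pi * τ.im * (a : ℝ) := by
    have := τ.im_pos
    have : (0 : ℝ) < a := Rat.cast_pos.2 ha
    positivity
  have hsupport : Function.support (thetaTerm σ k a φ h τ) ⊆
      {x : K | x ∈ (I : FractionalIdeal (𝓞 K)⁰ K)} := by
    intro x hx
    refine hI x fun h0 => hx ?_
    rw [thetaTerm, h0, zero_mul, zero_mul]
  rw [← Set.indicator_eq_self.2 hsupport, ← summable_subtype_iff_indicator]
  refine (summable_fractionalIdeal σ I (k - 1) hc).of_norm_bounded fun x => ?_
  rw [Function.comp_apply, norm_thetaTerm]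
  exact mul_le_of_le_one_left (by positivity) (hφ _)

theorem summable_thetaTerm {m : Ideal (𝓞 K)} (hm : m ≠ ⊥) {t : 𝔸ᶠ[K]ˣ} {r : K}
    (hr : r ∈ (ideleIdeal t : FractionalIdeal (𝓞 K)⁰ K)) (h : 𝔸ᶠ[K]ˣ) (τ : ℍ) :
    Summable (thetaTerm σ k
      (FractionalIdeal.absNorm (ideleIdeal t : FractionalIdeal (𝓞 K)⁰ K))⁻¹
        (cosetIndicator ((m : FractionalIdeal (𝓞 K)⁰ K) *
          (ideleIdeal t : FractionalIdeal (𝓞 K)⁰ K)) r) h τ) :=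
  summable_thetaTerm_of_support
    (inv_pos.2 ((FractionalIdeal.absNorm_nonneg _).lt_of_ne' fun h0 =>
      Units.ne_zero _ (FractionalIdeal.absNorm_eq_zero_iff.1 h0)))
    (norm_cosetIndicator_le _ _) h (ideleIdeal (normMinus K h * t))
    (fun _ hx => mem_of_inv_mul_sub_mem_hat hm hr (cosetIndicator_ne_zero_iff.1 hx)) τ

end Convergence

/-! ### Sums over ideal classes -/

section Generators

variable {R K : Type*} [CommRing R] [IsDedekindDomain R] [Field K] [Algebra R K]
  [IsFractionRing R K] {B : (FractionalIdeal R⁰ K)ˣ}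

theorem exists_toPrincipalIdeal_eq_mul {a : (Ideal R)⁰}
    (ha : ClassGroup.mk0 a = (ClassGroup.mk K B)⁻¹) :
    ∃ y : Kˣ, toPrincipalIdeal R K y = FractionalIdeal.mk0 K a * B := by
  rw [← classGroup_mk_eq_one_iff, map_mul, ClassGroup.mk_mk0, ha, inv_mul_cancel]

theorem mem_of_toPrincipalIdeal_eq {a : (Ideal R)⁰} {y : Kˣ}
    (hy : toPrincipalIdeal R K y = FractionalIdeal.mk0 K a * B) :
    (y : K) ∈ (B : FractionalIdeal R⁰ K) := by
  rw [toPrincipalIdeal_eq_iff, Units.val_mul, FractionalIdeal.coe_mk0] at hy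
  rw [← FractionalIdeal.spanSingleton_le_iff_mem, hy]
  exact mul_le_of_le_one_left' FractionalIdeal.coeIdeal_le_one

theorem exists_mk0_eq_of_mem {y : Kˣ} (hy : (y : K) ∈ (B : FractionalIdeal R⁰ K)) :
    ∃ a : (Ideal R)⁰, ClassGroup.mk0 a = (ClassGroup.mk K B)⁻¹ ∧
      toPrincipalIdeal R K y = FractionalIdeal.mk0 K a * B := by
  have hle : ((toPrincipalIdeal R K y * B⁻¹ : (FractionalIdeal R⁰ K)ˣ) :
      FractionalIdeal R⁰ K) ≤ 1 := by
    rw [Units.val_mul, coe_toPrincipalIdeal, ← B.mul_inv]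
    gcongr
    rwa [FractionalIdeal.spanSingleton_le_iff_mem]
  obtain ⟨a, ha⟩ := FractionalIdeal.le_one_iff_exists_coeIdeal.1 hle
  have ha0 : a ≠ 0 := by
    rintro rfl
    exact (Units.ne_zero _) (ha.symm.trans FractionalIdeal.coeIdeal_bot)
  have hmk0 : FractionalIdeal.mk0 K ⟨a, mem_nonZeroDivisors_of_ne_zero ha0⟩ =
      toPrincipalIdeal R K y * B⁻¹ := Units.ext ha
  refine ⟨⟨a, mem_nonZeroDivisors_of_ne_zero ha0⟩, ?_, by rw [hmk0, inv_mul_cancel_right]⟩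
  rw [← ClassGroup.mk_mk0 K, hmk0, map_mul, map_inv, classGroup_mk_eq_one_iff.2 ⟨y, rfl⟩, one_mul]

/-- The unit `p.2` times a chosen generator of the principal fractional ideal `aB`, where `a` is
the integral ideal `p.1`. As `p` varies this lists each nonzero element of `B` once. -/
def generatorMul (B : (FractionalIdeal R⁰ K)ˣ)
    (p : {a : (Ideal R)⁰ // ClassGroup.mk0 a = (ClassGroup.mk K B)⁻¹} × Rˣ) : Kˣ :=
  Units.map (algebraMap R K : R →* K) p.2 * (exists_toPrincipalIdeal_eq_mul p.1.2).choose

theorem toPrincipalIdeal_generatorMul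
    (p : {a : (Ideal R)⁰ // ClassGroup.mk0 a = (ClassGroup.mk K B)⁻¹} × Rˣ) :
    toPrincipalIdeal R K (generatorMul B p) = FractionalIdeal.mk0 K p.1.1 * B := by
  rw [generatorMul, map_mul, toPrincipalIdeal_eq_one_iff.2 ⟨p.2, rfl⟩, one_mul]
  exact (exists_toPrincipalIdeal_eq_mul p.1.2).choose_spec

theorem generatorMul_injective (B : (FractionalIdeal R⁰ K)ˣ) :
    Function.Injective fun p => (generatorMul B p : K) := by
  rintro ⟨a, u⟩ ⟨b, w⟩ hpq
  have hgen : generatorMul B (a, u) = generatorMul B (b, w) := Units.ext hpq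
  obtain rfl : a = b := by
    have hideal := congrArg (toPrincipalIdeal R K) hgen
    rw [toPrincipalIdeal_generatorMul, toPrincipalIdeal_generatorMul, mul_left_inj] at hideal
    exact Subtype.ext (Subtype.ext
      (FractionalIdeal.coeIdeal_injective (K := K) (congrArg Units.val hideal)))
  have hunit := congrArg Units.val (mul_right_cancel hgen)
  exact Prod.ext rfl (Units.ext (FaithfulSMul.algebraMap_injective R K hunit))

theorem exists_generatorMul_eq {y : Kˣ} (hy : (y : K) ∈ (B : FractionalIdeal R⁰ K)) :
    ∃ p, generatorMul B p = y := by
  obtain ⟨a, ha, hya⟩ := exists_mk0_eq_of_mem hy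
  have hideal := toPrincipalIdeal_generatorMul ⟨⟨a, ha⟩, 1⟩
  rw [← hya] at hideal
  obtain ⟨u, hu⟩ := toPrincipalIdeal_eq_one_iff.1
    (show toPrincipalIdeal R K (y * (generatorMul B ⟨⟨a, ha⟩, 1⟩)⁻¹) = 1 by
      rw [map_mul, map_inv, hideal, mul_inv_cancel])
  exact ⟨⟨⟨a, ha⟩, u⟩, by rw [generatorMul, hu]; simp [generatorMul]⟩

end Generators

namespace HeckeCharacter

variable {K : Type*} [Field K] [NumberField K] {m : Ideal (𝓞 K)} {σ : K →+* ℂ} {k : ℕ}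
  (ϱ : HeckeCharacter σ k m)

theorem classTerm_generatorMul (τ : ℍ) {B : (FractionalIdeal (𝓞 K)⁰ K)ˣ}
    (p : {a : (Ideal (𝓞 K))⁰ // ClassGroup.mk0 a = (ClassGroup.mk K B)⁻¹} × (𝓞 K)ˣ) :
    ϱ.classTerm τ B (generatorMul B p) = ϱ.formTerm τ p.1.1 := by
  have hideal := toPrincipalIdeal_generatorMul p
  rw [classTerm, dif_pos ⟨(generatorMul B p).ne_zero, mem_of_toPrincipalIdeal_eq hideal⟩,
    Units.mk0_val, hideal, mul_inv_cancel_right, fracTerm_mk0]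

theorem support_classTerm_subset (τ : ℍ) (B : (FractionalIdeal (𝓞 K)⁰ K)ˣ) :
    Function.support (ϱ.classTerm τ B) ⊆ Set.range fun p => (generatorMul B p : K) := by
  intro y hy
  obtain ⟨hy0, hyB⟩ : y ≠ 0 ∧ y ∈ (B : FractionalIdeal (𝓞 K)⁰ K) :=
    by_contra fun h => hy (dif_neg h)
  obtain ⟨p, hp⟩ := exists_generatorMul_eq (y := Units.mk0 y hy0) hyB
  exact ⟨p, congrArg Units.val hp⟩

/-- The part of the form `ϑ_ϱ` that comes from the integral ideals in the class `d`. -/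
def classSum (τ : ℍ) (d : ClassGroup (𝓞 K)) : ℂ :=
  ∑' a : {a : (Ideal (𝓞 K))⁰ // ClassGroup.mk0 a = d}, ϱ.formTerm τ a.1

variable {ϱ} {τ : ℍ}

theorem summable_formTerm_class {B : (FractionalIdeal (𝓞 K)⁰ K)ˣ}
    (h : Summable (ϱ.classTerm τ B)) :
    Summable fun a : {a : (Ideal (𝓞 K))⁰ // ClassGroup.mk0 a = (ClassGroup.mk K B)⁻¹} =>
      ϱ.formTerm τ a.1 :=
  ((h.comp_injective (generatorMul_injective B)).comp_injective
    (Prod.mk_left_injective (1 : (𝓞 K)ˣ))).congr fun a => ϱ.classTerm_generatorMul τ (a, 1)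

theorem tsum_classTerm {B : (FractionalIdeal (𝓞 K)⁰ K)ˣ} (h : Summable (ϱ.classTerm τ B)) :
    ∑' y, ϱ.classTerm τ B y = Nat.card (𝓞 K)ˣ * ϱ.classSum τ (ClassGroup.mk K B)⁻¹ := by
  rw [← (generatorMul_injective B).tsum_eq (ϱ.support_classTerm_subset τ B), classSum,
    ← tsum_mul_left]
  refine (h.comp_injective (generatorMul_injective B)).tsum_prod.trans (tsum_congr fun a => ?_)
  rw [← nsmul_eq_mul, ← tsum_const]
  exact tsum_congr fun u => ϱ.classTerm_generatorMul τ (a, u)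

theorem summable_formTerm_of_classes (h : ∀ d : ClassGroup (𝓞 K),
    Summable fun a : {a : (Ideal (𝓞 K))⁰ // ClassGroup.mk0 a = d} => ϱ.formTerm τ a.1) :
    Summable (ϱ.formTerm τ) := by
  rw [← summable_norm_iff, ← (Equiv.sigmaFiberEquiv (ClassGroup.mk0 (R := 𝓞 K))).summable_iff]
  exact (summable_sigma_of_nonneg fun _ => norm_nonneg _).2
    ⟨fun d => (h d).norm, Summable.of_finite⟩

theorem sum_classSum (h : Summable (ϱ.formTerm τ)) : ∑ d, ϱ.classSum τ d = ϱ.form τ := by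
  rw [form, ← (Equiv.sigmaFiberEquiv (ClassGroup.mk0 (R := 𝓞 K))).tsum_eq,
    Summable.tsum_sigma, tsum_fintype]
  · rfl
  · exact (Equiv.summable_iff _).2 h

variable (ϱ)

/-- The constant term of the theta series attached to an ideal class. It is computed from a chosen
representative; `constClass_mk` shows that the choice does not matter. -/
def constClass (d : ClassGroup (𝓞 K)) : ℂ :=
  ϱ.constTerm (Function.surjInv (classGroup_mk_surjective (𝓞 K) K) d)

theorem constTerm_mul {I : (FractionalIdeal (𝓞 K)⁰ K)ˣ} (hI : I ∈ coprimeIdeals m)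
    (J : (FractionalIdeal (𝓞 K)⁰ K)ˣ) :
    ϱ.constTerm (I * J) = (ϱ.onIdeal I)⁻¹ * ϱ.constTerm J := by
  rw [constTerm, constTerm]
  split_ifs
  · rw [ϱ.onIdeal_mul hI, mul_inv]
  · rw [mul_zero]

theorem constTerm_toPrincipalIdeal_mul (hm : m ≠ ⊥) (x : Kˣ) (J : (FractionalIdeal (𝓞 K)⁰ K)ˣ) :
    ϱ.constTerm (toPrincipalIdeal (𝓞 K) K x * J) = ϱ.constTerm J := by
  by_cases h : k = 1 ∧ m = ⊤
  · have hnot : ∀ v : HeightOneSpectrum (𝓞 K), ¬ m ≤ v.asIdeal := fun v hv =>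
      v.isPrime.ne_top (top_le_iff.1 (h.2 ▸ hv))
    rw [constTerm_mul ϱ (fun v hv => (hnot v hv).elim),
      ϱ.onIdeal_toPrincipalIdeal hm (fun v hv => (hnot v hv).elim),
      show k - 1 = 0 by omega, pow_zero, inv_one, one_mul]
  · rw [constTerm, constTerm, if_neg h, if_neg h]

theorem constClass_mk (hm : m ≠ ⊥) (B : (FractionalIdeal (𝓞 K)⁰ K)ˣ) :
    ϱ.constClass (ClassGroup.mk K B) = ϱ.constTerm B := by
  have hJ := Function.surjInv_eq (classGroup_mk_surjective (𝓞 K) K) (ClassGroup.mk K B)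
  rw [constClass]
  set J := Function.surjInv (classGroup_mk_surjective (𝓞 K) K) (ClassGroup.mk K B)
  obtain ⟨x, hx⟩ := classGroup_mk_eq_one_iff.1
    (show ClassGroup.mk K (J * B⁻¹) = 1 by rw [map_mul, map_inv, hJ, mul_inv_cancel])
  rw [← ϱ.constTerm_toPrincipalIdeal_mul hm x B, hx, inv_mul_cancel_right]

theorem sum_constClass (hm : m ≠ ⊥) (hϱ : k = 1 → ∃ a, ϱ.toHom a ≠ 1) :
    ∑ d, ϱ.constClass d = 0 := by
  by_cases h : k = 1 ∧ m = ⊤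
  · obtain ⟨a, ha⟩ := hϱ h.1
    have hval : ϱ.onIdeal a = (ϱ.toHom a : ℂ) := by rw [onIdeal, dif_pos a.2]
    have htranslate : ∀ d, ϱ.constClass (ClassGroup.mk K (a : (FractionalIdeal (𝓞 K)⁰ K)ˣ) * d) =
        (ϱ.toHom a : ℂ)⁻¹ * ϱ.constClass d := by
      intro d
      obtain ⟨J, rfl⟩ := classGroup_mk_surjective (𝓞 K) K d
      rw [← map_mul, ϱ.constClass_mk hm, ϱ.constClass_mk hm, ϱ.constTerm_mul a.2, hval]
    have hinvariant : (ϱ.toHom a : ℂ)⁻¹ * ∑ d, ϱ.constClass d = ∑ d, ϱ.constClass d := by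
      rw [Finset.mul_sum, ← Equiv.sum_comp (Equiv.mulLeft (ClassGroup.mk K a.1)) ϱ.constClass]
      exact Finset.sum_congr rfl fun d _ => (htranslate d).symm
    by_contra hsum
    exact ha (Units.ext (inv_eq_one.1 ((mul_eq_right₀ hsum).1 hinvariant)))
  · exact Finset.sum_eq_zero fun d _ => by rw [constClass, constTerm, if_neg h]

/-- The value at `τ` of `∑_μ ϱ(t)⁻¹ η(μ) ϱ(h/h̄)⁻¹ θ_{P+μ}(τ, h)`, which depends only on the ideal
class `d` of `t (h/h̄)`; see `thetaSum_eq`. -/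
def classValue (τ : ℍ) (d : ClassGroup (𝓞 K)) : ℂ :=
  Nat.card (𝓞 K)ˣ * ϱ.classSum τ d⁻¹ + ϱ.constClass d

theorem sum_classValue (hm : m ≠ ⊥) (hϱ : k = 1 → ∃ a, ϱ.toHom a ≠ 1)
    (h : Summable (ϱ.formTerm τ)) : ∑ d, ϱ.classValue τ d = Nat.card (𝓞 K)ˣ * ϱ.form τ := by
  simp only [classValue]
  rw [Finset.sum_add_distrib, ϱ.sum_constClass hm hϱ, add_zero, ← Finset.mul_sum,
    ← sum_classSum h]
  exact congrArg _ (Equiv.sum_comp (Equiv.inv _) _)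

end HeckeCharacter

/-! ### Averaging over class groups -/

section Averages

theorem card_mul_sum_comp {G H R : Type*} [Group G] [Group H] [Fintype G] [Fintype H]
    [CommSemiring R] {f : G →* H} (hf : Function.Surjective f) (F : H → R) :
    (Nat.card H : R) * ∑ x, F (f x) = Nat.card G * ∑ y, F y := by
  have htranslate (z : H) : ∑ x, F (z * f x) = ∑ x, F (f x) := by
    obtain ⟨w, rfl⟩ := hf z
    rw [← Equiv.sum_comp (Equiv.mulLeft w) fun x => F (f x)]
    simp
  calc (Nat.card H : R) * ∑ x, F (f x) = ∑ z : H, ∑ x, F (z * f x) := by simp [htranslate]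
    _ = ∑ x : G, ∑ z, F (z * f x) := Finset.sum_comm
    _ = ∑ x : G, ∑ z, F z := Finset.sum_congr rfl fun x _ => Equiv.sum_comp (Equiv.mulRight (f x)) F
    _ = Nat.card G * ∑ y, F y := by simp

theorem mul_sum_comp_hom_of_forall {ι κ C G R : Type*} [Fintype ι] [Fintype κ] [Group C] [Fintype C]
    [Group G] [Fintype G] [CommSemiring R] (f : G →* C) {a : ι → C} {b : κ → G} {w : R}
    (hw : ∀ F : C → R, w * ∑ i, ∑ j, F (a i * f (b j)) = ∑ d, F d) (F : C → R) :
    w * (Nat.card κ * ∑ i, ∑ c, F (a i * f c)) = Nat.card G * ∑ d, F d := by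
  have htranslate (i : ι) (j : κ) : ∑ c, F (a i * f (b j) * f c) = ∑ c, F (a i * f c) := by
    rw [← Equiv.sum_comp (Equiv.mulLeft (b j)) fun c => F (a i * f c)]
    simp [mul_assoc]
  calc w * (Nat.card κ * ∑ i, ∑ c, F (a i * f c))
      = w * ∑ i, ∑ j, ∑ c, F (a i * f (b j) * f c) := by simp [htranslate, Finset.mul_sum]
    _ = ∑ c, w * ∑ i, ∑ j, F (a i * f (b j) * f c) := by
        rw [← Finset.mul_sum]
        exact congrArg _ ((Finset.sum_congr rfl fun i _ => Finset.sum_comm).trans Finset.sum_comm)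
    _ = ∑ c, ∑ d, F (d * f c) := Finset.sum_congr rfl fun c _ => hw fun d => F (d * f c)
    _ = ∑ c : G, ∑ d, F d := Finset.sum_congr rfl fun c _ => Equiv.sum_comp (Equiv.mulRight (f c)) F
    _ = Nat.card G * ∑ d, F d := by simp

variable {K : Type*} [Field K] [NumberField K] {Kf : Subgroup 𝔸ᶠ[K]ˣ}

/-- The map `Cl(K_f) → Cl(K)` for a subgroup `K_f` of `Ô_K^×`. -/
def classMap (hle : Kf ≤ integralUnits K) : IdeleClassGroup Kf →* ClassGroup (𝓞 K) :=
  QuotientGroup.lift _ (ideleClass K) (le_ker_ideleClass hle)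

theorem classMap_surjective (hle : Kf ≤ integralUnits K) : Function.Surjective (classMap hle) :=
  QuotientGroup.lift_surjective_of_surjective _ _ (ideleClass_surjective K) _

theorem IsLevel.finite_ideleClassGroup [Algebra.IsQuadraticExtension ℚ K] [IsTotallyComplex K]
    {σ : K →+* ℂ} {k : ℕ} {m : Ideal (𝓞 K)} {ϱ : HeckeCharacter σ k m} {f : 𝔸ᶠ[K] → ℂ}
    (h : IsLevel ϱ f Kf) : Finite (IdeleClassGroup Kf) := by
  have := finite_units K
  exact (finite_ideleClassGroup_iff h.le_integralUnits).2 (relIndex_integralUnits_ne_zero h.isOpen)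

theorem vol_mul_sum_classMap [Finite (𝓞 K)ˣ] (hle : Kf ≤ integralUnits K)
    [Fintype (IdeleClassGroup Kf)] (F : ClassGroup (𝓞 K) → ℂ) :
    vol Kf * ∑ c, F (classMap hle c) = ∑ d, F d := by
  have hclass : (Nat.card (ClassGroup (𝓞 K)) : ℂ) ≠ 0 := Nat.cast_ne_zero.2 Nat.card_pos.ne'
  apply mul_left_cancel₀ hclass
  rw [mul_left_comm, card_mul_sum_comp (classMap_surjective hle), ← mul_assoc,
    vol_mul_card_ideleClassGroup hle]

variable [Algebra.IsQuadraticExtension ℚ K] [IsTotallyComplex K]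

theorem le_ker_ideleClass_comp_normMinus (hle : Kf ≤ integralUnits K) :
    (FiniteAdeleRing.unitEmbedding (𝓞 K) K).range ⊔ Kf ≤
      ((ideleClass K).comp (normMinus K)).ker := by
  refine sup_le ?_ fun u hu => ?_
  · rintro _ ⟨α, rfl⟩
    rw [MonoidHom.mem_ker, MonoidHom.comp_apply, normMinus_unitEmbedding, ideleClass_unitEmbedding]
  · rw [MonoidHom.mem_ker, MonoidHom.comp_apply, ← MonoidHom.mem_ker, ker_ideleClass]
    exact Subgroup.mem_sup_right (normMinus_mem_integralUnits (hle hu))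

/-- The map `Cl(K_f) → Cl(K)` induced by `Nm⁻`. -/
def normMinusClassMap (hle : Kf ≤ integralUnits K) : IdeleClassGroup Kf →* ClassGroup (𝓞 K) :=
  QuotientGroup.lift _ ((ideleClass K).comp (normMinus K)) (le_ker_ideleClass_comp_normMinus hle)

theorem normMinusClassMap_mk (hle : Kf ≤ integralUnits K) (h : 𝔸ᶠ[K]ˣ) :
    normMinusClassMap hle (QuotientGroup.mk h) = ideleClass K (normMinus K h) :=
  rfl

theorem normMinusClassMap_eq_out (hle : Kf ≤ integralUnits K) (c : IdeleClassGroup Kf) :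
    normMinusClassMap hle c = ideleClass K (normMinus K c.out) := by
  rw [← normMinusClassMap_mk hle, QuotientGroup.out_eq']

variable {m : Ideal (𝓞 K)} {ι κ : Type*} [Fintype ι] [Fintype κ] {t : ι → 𝔸ᶠ[K]ˣ} {h : κ → 𝔸ᶠ[K]ˣ}
  (hreps : Function.Bijective fun p : ι × κ =>
    (QuotientGroup.mk (t p.1 * normMinus K (h p.2)) : IdeleClassGroup (levelSubgroup m)))
include hreps

theorem vol_mul_sum_representatives (F : ClassGroup (𝓞 K) → ℂ) :
    vol (levelSubgroup m) * ∑ i, ∑ j, F (ideleClass K (t i * normMinus K (h j))) = ∑ d, F d := by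
  have := finite_units K
  have := Fintype.ofBijective _ hreps
  have hle : levelSubgroup m ≤ integralUnits K := fun _ hu => hu.1
  rw [← vol_mul_sum_classMap hle, ← Fintype.sum_prod_type']
  exact congrArg _ (hreps.sum_comp fun c => F (classMap hle c))

omit [Fintype ι] [Fintype κ] in
theorem vol_levelSubgroup_mul_card [Finite ι] [Finite κ] :
    vol (levelSubgroup m) * (Nat.card ι * Nat.card κ) = Nat.card (ClassGroup (𝓞 K)) := by
  have := Fintype.ofFinite ι
  have := Fintype.ofFinite κ
  simpa using vol_mul_sum_representatives hreps 1

omit [Fintype κ] in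
theorem vol_mul_sum_ideleClassGroup [Finite κ] (hle : Kf ≤ integralUnits K)
    [Fintype (IdeleClassGroup Kf)] (F : ClassGroup (𝓞 K) → ℂ) :
    vol Kf * ∑ i, ∑ c : IdeleClassGroup Kf, F (ideleClass K (t i * normMinus K c.out)) =
      Nat.card ι * ∑ d, F d := by
  have := finite_units K
  have := Fintype.ofFinite κ
  have hlevel := vol_levelSubgroup_mul_card hreps
  have hclass : (Nat.card (ClassGroup (𝓞 K)) : ℂ) ≠ 0 := Nat.cast_ne_zero.2 Nat.card_pos.ne'
  have hvol := vol_mul_card_ideleClassGroup hle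
  have hreps_sum (F : ClassGroup (𝓞 K) → ℂ) : vol (levelSubgroup m) * ∑ i, ∑ j,
      F (ideleClass K (t i) * normMinusClassMap hle (QuotientGroup.mk (h j))) = ∑ d, F d := by
    simpa only [normMinusClassMap_mk, ← map_mul] using vol_mul_sum_representatives hreps F
  have haverage := mul_sum_comp_hom_of_forall _ hreps_sum F
  simp only [normMinusClassMap_eq_out, ← map_mul] at haverage
  rw [← hlevel] at hclass hvol
  apply mul_left_cancel₀ (left_ne_zero_of_mul hclass)
  apply mul_left_cancel₀ (right_ne_zero_of_mul (right_ne_zero_of_mul hclass))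
  linear_combination vol Kf * haverage + (∑ d, F d) * hvol

end Averages

namespace HeckeCharacter

variable {K : Type*} [Field K] [NumberField K] [Algebra.IsQuadraticExtension ℚ K]
  [IsTotallyComplex K] {m : Ideal (𝓞 K)} {σ : K →+* ℂ} {k : ℕ} (ϱ : HeckeCharacter σ k m)
  [Fintype (𝓞 K ⧸ m)ˣ]

/-- The sum `∑_μ ϱ(t)⁻¹ η(μ) ϱ(h/h̄)⁻¹ θ_{P+μ}(τ, h)` over the residue classes, where `P` is the
lattice `(𝔪𝔞, Nm(𝔞)⁻¹ Nm)` for the ideal `𝔞` of `t`. -/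
def thetaSum (t h : 𝔸ᶠ[K]ˣ) (r : (𝓞 K ⧸ m)ˣ → Kˣ) (τ : ℍ) : ℂ :=
  ∑ μ, (ϱ.onIdele t)⁻¹ * ϱ.eta (r μ) * ((ϱ.onIdele (normMinus K h))⁻¹ *
    theta σ k (FractionalIdeal.absNorm (ideleIdeal t : FractionalIdeal (𝓞 K)⁰ K))⁻¹
      (cosetIndicator ((m : FractionalIdeal (𝓞 K)⁰ K) *
        (ideleIdeal t : FractionalIdeal (𝓞 K)⁰ K)) (r μ)) h τ)

variable (hm : m ≠ ⊥)
include hm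

section Single

variable {t : 𝔸ᶠ[K]ˣ} {r : (𝓞 K ⧸ m)ˣ → Kˣ}
  (hrt : ∀ μ, (r μ : K) ∈ (ideleIdeal t : FractionalIdeal (𝓞 K)⁰ K))
include hrt

theorem hasSum_sum_twistedTerm (h : 𝔸ᶠ[K]ˣ) (α : Kˣ) (τ : ℍ) :
    HasSum (fun y : K => ∑ μ, ϱ.twistedTerm t h (r μ) τ ((α : K)⁻¹ * y)) (ϱ.thetaSum t h r τ) :=
  hasSum_sum fun μ _ =>
    (((Equiv.mulLeft₀ _ (inv_ne_zero α.ne_zero)).hasSum_iff.2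
      (summable_thetaTerm hm (hrt μ) h τ).hasSum).mul_left _).mul_left _

variable (hk : 1 ≤ k) (ht : t ∈ coprimeIdeles m) (hr : IsResidueSystem m r)
include hk ht hr

theorem exists_hasSum_classTerm (h : 𝔸ᶠ[K]ˣ) (τ : ℍ) : ∃ B : (FractionalIdeal (𝓞 K)⁰ K)ˣ,
    ClassGroup.mk K B = ideleClass K (t * normMinus K h) ∧
      HasSum (ϱ.classTerm τ B) (ϱ.thetaSum t h r τ - ϱ.constTerm B) := by
  classical
  obtain ⟨α, hα⟩ := exists_unitEmbedding_mul_mem_coprimeIdeles hm (normMinus K h)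
  refine ⟨ideleIdeal (FiniteAdeleRing.unitEmbedding (𝓞 K) K α * normMinus K h * t), ?_, ?_⟩
  · change ideleClass K _ = _
    rw [mul_assoc, map_mul, ideleClass_unitEmbedding, one_mul, mul_comm]
  · have hsum := ϱ.hasSum_sum_twistedTerm hm hrt h α τ
    simp_rw [fun y => ϱ.sum_twistedTerm_inv_mul hm ht hα hk hrt hr τ y rfl] at hsum
    set B := ideleIdeal (FiniteAdeleRing.unitEmbedding (𝓞 K) K α * normMinus K h * t)
    simpa only [add_sub_cancel_right] using hsum.sub (hasSum_ite_eq (0 : K) (ϱ.constTerm B))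

theorem thetaSum_eq (h : 𝔸ᶠ[K]ˣ) (τ : ℍ) :
    ϱ.thetaSum t h r τ = ϱ.classValue τ (ideleClass K (t * normMinus K h)) := by
  obtain ⟨B, hB, hsum⟩ := ϱ.exists_hasSum_classTerm hm hrt hk ht hr h τ
  rw [classValue, ← hB, ϱ.constClass_mk hm, ← tsum_classTerm hsum.summable, hsum.tsum_eq,
    sub_add_cancel]

omit [Fintype (𝓞 K ⧸ m)ˣ] in
theorem summable_formTerm_class_ideleClass (h : 𝔸ᶠ[K]ˣ) (τ : ℍ) :
    Summable fun a : {a : (Ideal (𝓞 K))⁰ //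
      ClassGroup.mk0 a = (ideleClass K (t * normMinus K h))⁻¹} => ϱ.formTerm τ a.1 := by
  have := Ideal.finiteQuotientOfFreeOfNeBot m hm
  have := Fintype.ofFinite (𝓞 K ⧸ m)ˣ
  obtain ⟨B, hB, hsum⟩ := ϱ.exists_hasSum_classTerm hm hrt hk ht hr h τ
  exact hB ▸ summable_formTerm_class hsum.summable

end Single

section Family

variable (hk : 1 ≤ k) {ι κ : Type*} {t : ι → 𝔸ᶠ[K]ˣ} (ht : ∀ i, t i ∈ coprimeIdeles m)
  {r : ι → (𝓞 K ⧸ m)ˣ → Kˣ}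
  (hrt : ∀ i μ, (r i μ : K) ∈ (ideleIdeal (t i) : FractionalIdeal (𝓞 K)⁰ K))
  (hr : ∀ i, IsResidueSystem m (r i))
include hk ht hrt hr

omit [Fintype (𝓞 K ⧸ m)ˣ] in
theorem sum_finsum_mul_sum_theta [Fintype ι] [Fintype κ] (v : ℂ) (g : κ → 𝔸ᶠ[K]ˣ) (τ : ℍ) :
    ∑ i, ∑ᶠ μ, (ϱ.onIdele (t i))⁻¹ * ϱ.eta (r i μ) *
        (v * ∑ c, (ϱ.onIdele (normMinus K (g c)))⁻¹ *
          theta σ k (FractionalIdeal.absNorm (ideleIdeal (t i) : FractionalIdeal (𝓞 K)⁰ K))⁻¹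
            (cosetIndicator ((m : FractionalIdeal (𝓞 K)⁰ K) *
              (ideleIdeal (t i) : FractionalIdeal (𝓞 K)⁰ K)) (r i μ)) (g c) τ) =
      v * ∑ i, ∑ c, ϱ.classValue τ (ideleClass K (t i * normMinus K (g c))) := by
  have := Ideal.finiteQuotientOfFreeOfNeBot m hm
  have := Fintype.ofFinite (𝓞 K ⧸ m)ˣ
  simp_rw [← fun i => ϱ.thetaSum_eq hm (hrt i) hk (ht i) (hr i), thetaSum]
  rw [Finset.mul_sum]
  refine Finset.sum_congr rfl fun i _ => ?_
  rw [finsum_eq_sum_of_fintype, Finset.sum_comm, Finset.mul_sum]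
  refine Finset.sum_congr rfl fun μ _ => ?_
  rw [← Finset.mul_sum]
  ring

omit [Fintype (𝓞 K ⧸ m)ˣ] in
theorem summable_formTerm {h : κ → 𝔸ᶠ[K]ˣ}
    (hreps : Function.Surjective fun p : ι × κ =>
      (QuotientGroup.mk (t p.1 * normMinus K (h p.2)) : IdeleClassGroup (levelSubgroup m)))
    (τ : ℍ) : Summable (ϱ.formTerm τ) := by
  refine summable_formTerm_of_classes fun d => ?_
  obtain ⟨c, hc⟩ := classMap_surjective (Kf := levelSubgroup m) (fun _ hu => hu.1) d⁻¹
  obtain ⟨⟨i, j⟩, rfl⟩ := hreps c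
  have hd : ideleClass K (t i * normMinus K (h j)) = d⁻¹ := hc
  have hsum := ϱ.summable_formTerm_class_ideleClass hm (hrt i) hk (ht i) (hr i) (h j) τ
  rwa [hd, inv_inv] at hsum

end Family

end HeckeCharacter

end CMTheta
end

theorem mainTheorem8_general {K : Type*} [Field K] [NumberField K]
    [Algebra.IsQuadraticExtension ℚ K] [IsTotallyComplex K] (σ : K →+* ℂ) (k : ℕ) (hk : 1 ≤ k)
    (m : Ideal (𝓞 K)) (hm : m ≠ ⊥)
    (ϱ : CMTheta.HeckeCharacter σ k m) (hϱ : k = 1 → ∃ a, ϱ.toHom a ≠ 1)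
    {ι κ : Type*} [Fintype ι] [Fintype κ]
    (t : ι → (FiniteAdeleRing (𝓞 K) K)ˣ) (h : κ → (FiniteAdeleRing (𝓞 K) K)ˣ)
    (ht : ∀ i, t i ∈ CMTheta.coprimeIdeles m)
    (hreps : Function.Bijective fun p : ι × κ =>
      (QuotientGroup.mk (t p.1 * CMTheta.normMinus K (h p.2)) :
        CMTheta.IdeleClassGroup (CMTheta.levelSubgroup m)))
    (A : ι → FractionalIdeal (𝓞 K)⁰ K) (hA : ∀ i, A i = CMTheta.ideleIdeal (t i))
    (r : ι → (𝓞 K ⧸ m)ˣ → Kˣ)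
    (hr : ∀ i μ, (r i μ : K) ∈ A i ∧
      ∃ y : 𝓞 K, algebraMap (𝓞 K) K y = r i μ ∧ Ideal.Quotient.mk m y = μ)
    (φ : ι → (𝓞 K ⧸ m)ˣ → FiniteAdeleRing (𝓞 K) K → ℂ)
    (hφ : ∀ i μ, φ i μ = CMTheta.cosetIndicator ((m : FractionalIdeal (𝓞 K)⁰ K) * A i) (r i μ))
    (τ : ℍ) :
    Summable (ϱ.formTerm τ) ∧
    (∀ i μ g, Summable (CMTheta.thetaTerm σ k (FractionalIdeal.absNorm (A i))⁻¹ (φ i μ) g τ)) ∧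
    (∀ Kf : Subgroup (FiniteAdeleRing (𝓞 K) K)ˣ, (∀ i μ, CMTheta.IsLevel ϱ (φ i μ) Kf) →
      ϱ.form τ = ((Fintype.card ι : ℂ) * (Nat.card (𝓞 K)ˣ : ℂ))⁻¹ * ∑ i, ∑ᶠ μ : (𝓞 K ⧸ m)ˣ,
        (ϱ.onIdele (t i))⁻¹ * ϱ.eta (r i μ) *
          CMTheta.twistedTheta ϱ Kf (FractionalIdeal.absNorm (A i))⁻¹ (φ i μ) τ) ∧
    ϱ.form τ = (Nat.card (𝓞 K)ˣ : ℂ)⁻¹ * ∑ i, ∑ᶠ μ : (𝓞 K ⧸ m)ˣ,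
      (ϱ.onIdele (t i))⁻¹ * ϱ.eta (r i μ) *
        (CMTheta.vol (CMTheta.levelSubgroup m) *
          ∑ j, (ϱ.onIdele (CMTheta.normMinus K (h j)))⁻¹ *
            CMTheta.theta σ k (FractionalIdeal.absNorm (A i))⁻¹ (φ i μ) (h j) τ) := by
  have := CMTheta.finite_units K
  obtain rfl : A = fun i => (CMTheta.ideleIdeal (t i) : FractionalIdeal (𝓞 K)⁰ K) := funext hA
  obtain rfl := funext₂ hφ
  have hrt := fun i μ => (hr i μ).1
  have hres : ∀ i, CMTheta.IsResidueSystem m (r i) := fun i μ => (hr i μ).2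
  have hunits : (Nat.card (𝓞 K)ˣ : ℂ) ≠ 0 := Nat.cast_ne_zero.2 Nat.card_pos.ne'
  have hform := ϱ.summable_formTerm hm hk ht hrt hres hreps.2 τ
  have hclasses := ϱ.sum_classValue hm hϱ hform
  refine ⟨hform, fun i μ g => CMTheta.summable_thetaTerm hm (hrt i μ) g τ, fun Kf hKf => ?_, ?_⟩
  · obtain ⟨⟨i, -⟩, -⟩ := hreps.2 1
    have hι : (Fintype.card ι : ℂ) ≠ 0 := Nat.cast_ne_zero.2 (Fintype.card_pos_iff.2 ⟨i⟩).ne'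
    have := (hKf i 1).finite_ideleClassGroup
    have := Fintype.ofFinite (CMTheta.IdeleClassGroup Kf)
    simp only [CMTheta.twistedTheta,
      finsum_eq_sum_of_fintype (α := CMTheta.IdeleClassGroup Kf)]
    rw [ϱ.sum_finsum_mul_sum_theta hm hk ht hrt hres,
      CMTheta.vol_mul_sum_ideleClassGroup hreps (hKf i 1).le_integralUnits, hclasses,
      ← mul_assoc (Nat.card ι : ℂ), Nat.card_eq_fintype_card (α := ι),
      inv_mul_cancel_left₀ (mul_ne_zero hι hunits)]
  · rw [ϱ.sum_finsum_mul_sum_theta hm hk ht hrt hres, CMTheta.vol_mul_sum_representatives hreps,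
      hclasses, inv_mul_cancel_left₀ hunits]

theorem mainTheorem8 {K : Type*} [Field K] [NumberField K] [Algebra.IsQuadraticExtension ℚ K]
    [IsTotallyComplex K] (σ : K →+* ℂ) (k : ℕ) (hk : 1 ≤ k)
    (m : Ideal (𝓞 K)) (hm : m ≠ ⊥)
    (ϱ : CMTheta.HeckeCharacter σ k m) (hmod : ϱ.HasModulus)
    (hϱ : k = 1 → ∃ a, ϱ.toHom a ≠ 1)
    {ℓ n : ℕ} (t : Fin ℓ → (FiniteAdeleRing (𝓞 K) K)ˣ) (h : Fin n → (FiniteAdeleRing (𝓞 K) K)ˣ)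
    (ht : ∀ i, t i ∈ CMTheta.coprimeIdeles m) (hh : ∀ j, h j ∈ CMTheta.coprimeIdeles m)
    (hreps : Function.Bijective fun p : Fin ℓ × Fin n =>
      (QuotientGroup.mk (t p.1 * CMTheta.normMinus K (h p.2)) :
        CMTheta.IdeleClassGroup (CMTheta.levelSubgroup m)))
    (A : Fin ℓ → FractionalIdeal (𝓞 K)⁰ K) (hA : ∀ i, A i = CMTheta.ideleIdeal (t i))
    (r : Fin ℓ → (𝓞 K ⧸ m)ˣ → Kˣ)
    (hr : ∀ i μ, (r i μ : K) ∈ A i ∧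
      ∃ y : 𝓞 K, algebraMap (𝓞 K) K y = r i μ ∧ Ideal.Quotient.mk m y = μ)
    (φ : Fin ℓ → (𝓞 K ⧸ m)ˣ → FiniteAdeleRing (𝓞 K) K → ℂ)
    (hφ : ∀ i μ, φ i μ = CMTheta.cosetIndicator ((m : FractionalIdeal (𝓞 K)⁰ K) * A i) (r i μ))
    (τ : ℍ) :
    Summable (ϱ.formTerm τ) ∧
    (∀ i μ g, Summable (CMTheta.thetaTerm σ k (FractionalIdeal.absNorm (A i))⁻¹ (φ i μ) g τ)) ∧
    (∀ Kf : Subgroup (FiniteAdeleRing (𝓞 K) K)ˣ, (∀ i μ, CMTheta.IsLevel ϱ (φ i μ) Kf) →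
      ϱ.form τ = ((ℓ : ℂ) * (Nat.card (𝓞 K)ˣ : ℂ))⁻¹ * ∑ i, ∑ᶠ μ : (𝓞 K ⧸ m)ˣ,
        (ϱ.onIdele (t i))⁻¹ * ϱ.eta (r i μ) *
          CMTheta.twistedTheta ϱ Kf (FractionalIdeal.absNorm (A i))⁻¹ (φ i μ) τ) ∧
    ϱ.form τ = (Nat.card (𝓞 K)ˣ : ℂ)⁻¹ * ∑ i, ∑ᶠ μ : (𝓞 K ⧸ m)ˣ,
      (ϱ.onIdele (t i))⁻¹ * ϱ.eta (r i μ) *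
        (CMTheta.vol (CMTheta.levelSubgroup m) *
          ∑ j, (ϱ.onIdele (CMTheta.normMinus K (h j)))⁻¹ *
            CMTheta.theta σ k (FractionalIdeal.absNorm (A i))⁻¹ (φ i μ) (h j) τ) := by
  simpa only [Fintype.card_fin] using
    mainTheorem8_general σ k hk m hm ϱ hϱ t h ht hreps A hA r hr φ hφ τ
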